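/- All identities are between formal series, namely power series in $z$ whose coefficients are Laurent series in $q$ over $\mathbb{Q}$. Write $(a;q)_n=\prod_{0\le t<n}(1-aq^t)$ for $n\in\mathbb{Z}_{\ge 0}\cup\{\infty\}$ and $(q)_n=(q;q)_n$, with the convention $1/(q)_n=0$ for integers $n<0$. For a triple $c=(c_0,c_1,c_2)$ of non-negative integers, a cylindric partition of profile $c$ is a triple $\Lambda=(\lambda^{(0)},\lambda^{(1)},\lambda^{(2)})$ of partitions (weakly decreasing sequences of non-negative integers, eventually zero) such that for all $j\ge 1$ $$\lambda^{(0)}_j\ge\lambda^{(1)}_{j+c_1},\qquad \lambda^{(1)}_j\ge\lambda^{(2)}_{j+c_2},\qquad \lambda^{(2)}_j\ge\lambda^{(0)}_{j+c_0}.$$ Let $\max(\Lambda)$ be its largest part, $\mathrm{wt}(\Lambda)$ the sum of all its parts, and put $$F_c(z,q)=\sum_{\Lambda}z^{\max(\Lambda)}q^{\mathrm{wt}(\Lambda)},\qquad H_c(z,q)=\frac{(zq;q)_\infty}{(q;q)_\infty}F_c(z,q).$$ For $A,B,C,D\in\mathbb{Z}$ let $$S_{10}(A,B\mid C,D)=\sum_{r_1,r_2,s_1,s_2\ge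 0}\frac{z^{r_1}\,q^{r_1^2-r_1s_1+s_1^2+r_2^2-r_2s_2+s_2^2+Ar_1+Br_2+Cs_1+Ds_2}}{(q)_{r_1-r_2}(q)_{s_1-s_2}(q)_{r_2}(q)_{s_2}(q)_{r_2+s_2+1}}.$$ **Theorem.** The series $H_c$ for the compositions $c=(c_0,c_1,c_2)$ of $7$ (ordered triples of non-negative integers with sum $7$) satisfy the following identities. \begin{align*} H_{(7,0,0)}&=S_{10}(1,1\mid 1,1),\\ H_{(6,1,0)}&=S_{10}(0,1\mid 1,1),\\ H_{(5,2,0)}&=S_{10}(0,0\mid 1,1),\\ H_{(5,1,1)}&=S_{10}(0,1\mid 0,1)-qS_{10}(1,1\mid 1,1),\\ H_{(4,2,1)}&=S_{10}(0,0\mid 0,1)-qS_{10}(0,1\mid 1,1),\\ H_{(3,2,2)}&=S_{10}(0,0\mid 0,0)-qS_{10}(0,1\mid 0,1),\\ H_{(6,0,1)}&=S_{10}(1,1\mid 0,1)-q(1-z)S_{10}(2,1\mid 1,1),\\ H_{(5,0,2)}&=S_{10}(1,1\mid 0,0)-q(1-z)S_{10}(2,1\mid 0,1),\\ H_{(4,1,2)}&=S_{10}(0,1\mid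 0,0)-qS_{10}(1,1\mid 0,1),\\ H_{(4,3,0)}&=S_{10}(-1,0\mid 1,1)-S_{10}(0,1\mid 0,1)+(1-z)S_{10}(1,0\mid 0,1)+zqS_{10}(1,1\mid 1,1),\\ H_{(3,3,1)}&=S_{10}(-1,0\mid 0,1)-S_{10}(0,1\mid 0,0)+(1-z)S_{10}(1,0\mid 0,0)+zqS_{10}(1,1\mid 0,1)\\ &\quad-qS_{10}(-1,1\mid 1,1)-zS_{10}(0,0\mid 1,1),\\ H_{(4,0,3)}&=S_{10}(0,0\mid 0,1)-qS_{10}(0,1\mid 1,1)-zqS_{10}(1,0\mid 1,1)-S_{10}(1,1\mid 0,0)\\ &\quad+(1-qz)S_{10}(2,0\mid 0,0)+zq^2S_{10}(2,1\mid 0,1)+zqS_{10}(2,1\mid 0,0). \end{align*} Moreover, each identity remains true when the profile $c$ on its left side is replaced by either of its cyclic rotations $(c_1,c_2,c_0)$, $(c_2,c_0,c_1)$, with the same right side. As each of the $36$ compositions of $7$ is a cyclic rotation of exactly one of the twelve listed profiles, this gives $H_c$ for every length-$3$ composition $c$ of $7$. -/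

import Mathlib

namespace ASW

open PowerSeries

/-! Formal conventions.  A formal series in `z` and `q` is a power series in the outer variable `z`
whose coefficients are power series (or Laurent series) over `ℚ` in the inner variable `q`. -/

/-- The field `ℚ((q))` of formal Laurent series in `q`. -/
abbrev QLaurent : Type := LaurentSeries ℚ

/-- The variable `q`, as an element of `ℚ((q))[[z]]`. -/
noncomputable def qVar : PowerSeries QLaurent := C (HahnSeries.single (1 : ℤ) (1 : ℚ))

/-- The variable `z`, as an element of `ℚ((q))[[z]]`. -/
noncomputable def zVar : PowerSeries QLaurent := X

/-- The inclusion of `ℚ[[q]][[z]]` in `ℚ((q))[[z]]`. -/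
noncomputable def toLaurent : PowerSeries (PowerSeries ℚ) →+* PowerSeries QLaurent :=
  PowerSeries.map (HahnSeries.ofPowerSeries ℤ ℚ)

/-! ### Pochhammer symbols -/

/-- The finite Pochhammer symbol `(a; q)_n = ∏_{0 ≤ t < n} (1 - a q^t)` in a commutative ring. -/
def qPoch {R : Type*} [CommRing R] (a q : R) (n : ℕ) : R :=
  ∏ t ∈ Finset.range n, (1 - a * q ^ t)

/-- The infinite Pochhammer symbol `(a; q)_∞ = ∏_{t ≥ 0} (1 - a q^t)` for `a` in `ℚ[[q]][[z]]`.
The factors with `t > N` are congruent to `1` modulo `q^(N+1)`, so the coefficient of `z^n q^N` is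
the one in the partial product over `0 ≤ t ≤ N`. -/
noncomputable def qPochInf (a : PowerSeries (PowerSeries ℚ)) : PowerSeries (PowerSeries ℚ) :=
  PowerSeries.mk fun n => PowerSeries.mk fun N => coeff N (coeff n (qPoch a (C X) (N + 1)))

/-- The coefficients of the infinite Pochhammer symbol are the eventually constant values of those
of its partial products. -/
theorem coeff_qPoch_eq (a : PowerSeries (PowerSeries ℚ)) (n N M : ℕ) (h : N + 1 ≤ M) :
    coeff N (coeff n (qPoch a (C X) M)) = coeff N (coeff n (qPochInf a)) := by
  induction M, h using Nat.le_induction with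
  | base => simp [qPochInf]
  | succ M hM ih =>
    rw [← ih]
    have h1 : qPoch a (C X) (M + 1) = qPoch a (C X) M
        - C (X ^ M : PowerSeries ℚ) * (qPoch a (C X) M * a) := by
      rw [qPoch, Finset.prod_range_succ, ← qPoch, map_pow]
      ring
    rw [h1, map_sub, map_sub, PowerSeries.coeff_C_mul, PowerSeries.coeff_X_pow_mul',
      if_neg (by omega), sub_zero]

/-- `1 / (q)_n` in `ℚ[[q]]` for an integer `n`, where `(q)_n = (q; q)_n`; as usual it is `0` for
negative `n`. -/
noncomputable def invPoch (n : ℤ) : PowerSeries ℚ :=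
  if 0 ≤ n then (qPoch (X : PowerSeries ℚ) X n.toNat)⁻¹ else 0

/-! ### Cylindric partitions -/

/-- Cylindric partitions of profile `c = (c_0, …, c_r)`: sequences of partitions
`λ^(0), …, λ^(r)`, each weakly decreasing and eventually zero, such that
`λ^(i)_j ≥ λ^(i+1)_{j + c_(i+1)}` for all `i` and `j`, with the upper index read modulo `r + 1`.
Parts are indexed from `j = 0`. -/
structure CylindricPartition {r : ℕ} (c : Fin (r + 1) → ℕ) where
  part : Fin (r + 1) → ℕ → ℕ
  antitone : ∀ i, Antitone (part i)
  finite_support : ∀ i, (Function.support (part i)).Finite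
  cylindric : ∀ i j, part (i + 1) (j + c (i + 1)) ≤ part i j

/-- The maximum part. -/
def CylindricPartition.max {r : ℕ} {c : Fin (r + 1) → ℕ} (Λ : CylindricPartition c) : ℕ :=
  Finset.univ.sup fun i => Λ.part i 0

/-- The total weight: the sum of all the parts. -/
noncomputable def CylindricPartition.weight {r : ℕ} {c : Fin (r + 1) → ℕ}
    (Λ : CylindricPartition c) : ℕ :=
  ∑ i, ∑ᶠ j, Λ.part i j

/-- The generating function `F_c(z, q) = ∑_Λ z^max(Λ) q^wt(Λ)` of cylindric partitions of
profile `c`. -/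
noncomputable def F {r : ℕ} (c : Fin (r + 1) → ℕ) : PowerSeries (PowerSeries ℚ) :=
  PowerSeries.mk fun n => PowerSeries.mk fun N =>
    (Nat.card {Λ : CylindricPartition c // Λ.max = n ∧ Λ.weight = N} : ℚ)

/-- `H_c(z, q) = (zq; q)_∞ / (q; q)_∞ · F_c(z, q)`. -/
noncomputable def H {r : ℕ} (c : Fin (r + 1) → ℕ) : PowerSeries QLaurent :=
  toLaurent (qPochInf (X * C X)) * (toLaurent (qPochInf (C X)))⁻¹ * toLaurent (F c)

/-- The cyclic rotation `(c_i, c_(i+1), c_(i+2))` of `(c_0, c_1, c_2)`. -/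
def rot (i : Fin 3) (c : Fin 3 → ℕ) : Fin 3 → ℕ := fun j => c (j + i)

/-! ### The sums `S_10(A, B | C, D)` -/

/-- The exponent of `q` in the summand. -/
def expo (A B C D : ℤ) (r₁ r₂ s₁ s₂ : ℕ) : ℤ :=
  (r₁ : ℤ) ^ 2 - r₁ * s₁ + (s₁ : ℤ) ^ 2 + (r₂ : ℤ) ^ 2 - r₂ * s₂ + (s₂ : ℤ) ^ 2
    + A * r₁ + B * r₂ + C * s₁ + D * s₂

/-- The coefficient of `z^(r₁)` in the summand with indices `r₁, r₂, s₁, s₂`: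
`q^(r₁² - r₁s₁ + s₁² + r₂² - r₂s₂ + s₂² + A r₁ + B r₂ + C s₁ + D s₂)` divided by
`(q)_(r₁-r₂) (q)_(s₁-s₂) (q)_(r₂) (q)_(s₂) (q)_(r₂+s₂+1)`. -/
noncomputable def term (A B C D : ℤ) (r₁ r₂ s₁ s₂ : ℕ) : QLaurent :=
  HahnSeries.single (expo A B C D r₁ r₂ s₁ s₂) (1 : ℚ) *
    HahnSeries.ofPowerSeries ℤ ℚ
      (invPoch ((r₁ : ℤ) - r₂) * invPoch ((s₁ : ℤ) - s₂) * invPoch r₂ * invPoch s₂ *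
        invPoch ((r₂ : ℤ) + s₂ + 1))

theorem le_of_term_coeff_ne_zero {A B C D : ℤ} {r₁ r₂ s₁ s₂ : ℕ} {g : ℤ}
    (h : (term A B C D r₁ r₂ s₁ s₂).coeff g ≠ 0) :
    r₂ ≤ r₁ ∧ expo A B C D r₁ r₂ s₁ s₂ ≤ g := by
  constructor
  · by_contra hr
    apply h
    have : invPoch ((r₁ : ℤ) - r₂) = 0 := by
      rw [invPoch, if_neg (by omega)]
    simp [term, this]
  · by_contra hg
    apply h
    rw [term, HahnSeries.coeff_single_mul, one_mul]
    exact (PowerSeries.coeff_coe _ _).trans (if_pos (by omega))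

theorem expo_bound (A B C D : ℤ) (r₁ : ℕ) : ∃ L : ℤ, ∀ r₂ s₁ s₂ : ℕ, r₂ ≤ r₁ →
    (2 * (s₁ : ℤ) + C - r₁) ^ 2 + (2 * (s₂ : ℤ) + D - r₂) ^ 2
      ≤ 4 * expo A B C D r₁ r₂ s₁ s₂ + L := by
  refine ⟨-(4 * ((r₁ : ℤ) ^ 2 + A * r₁)) + (C - r₁) ^ 2 + D ^ 2 + |4 * B + 2 * D| * r₁, ?_⟩
  intro r₂ s₁ s₂ hr
  have h1 : -(4 * B + 2 * D) * (r₂ : ℤ) ≤ |4 * B + 2 * D| * r₁ :=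
    mul_le_mul (neg_le_abs _) (by exact_mod_cast hr) (by positivity) (abs_nonneg _)
  have h2 : (0 : ℤ) ≤ (r₂ : ℤ) ^ 2 := sq_nonneg _
  simp only [expo]
  nlinarith

/-- For fixed `r₁`, the family of the summands over `(r₂, s₁, s₂)` is summable: the exponents of
`q` are bounded below, and only finitely many summands contribute to each power of `q`. -/
noncomputable def termFamily (A B C D : ℤ) (r₁ : ℕ) :
    HahnSeries.SummableFamily ℤ ℚ (ℕ × ℕ × ℕ) where
  toFun p := term A B C D r₁ p.1 p.2.1 p.2.2
  isPWO_iUnion_support' := by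
    obtain ⟨L, hL⟩ := expo_bound A B C D r₁
    refine (BddBelow.isWF ⟨-|L|, ?_⟩).isPWO
    intro g hg
    obtain ⟨p, hp⟩ := Set.mem_iUnion.1 hg
    obtain ⟨h1, h2⟩ := le_of_term_coeff_ne_zero hp
    have h3 := hL p.1 p.2.1 p.2.2 h1
    have h4 := sq_nonneg (2 * (p.2.1 : ℤ) + C - r₁)
    have h5 := sq_nonneg (2 * (p.2.2 : ℤ) + D - p.1)
    have h6 := le_abs_self L
    have h7 := abs_nonneg L
    linarith
  finite_co_support' g := by
    obtain ⟨L, hL⟩ := expo_bound A B C D r₁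
    refine Set.Finite.subset (s := Set.Iic r₁ ×ˢ (Set.Iic (|4 * g + L| + |C| + r₁).toNat ×ˢ
      Set.Iic (|4 * g + L| + |D| + r₁).toNat))
      ((Set.finite_Iic _).prod ((Set.finite_Iic _).prod (Set.finite_Iic _))) ?_
    rintro ⟨r₂, s₁, s₂⟩ hp
    obtain ⟨h1, h2⟩ := le_of_term_coeff_ne_zero hp
    have h3 := hL r₂ s₁ s₂ h1
    have h4 := sq_nonneg (2 * (s₁ : ℤ) + C - r₁)
    have h5 := sq_nonneg (2 * (s₂ : ℤ) + D - r₂)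
    have h6 := le_abs_self (4 * g + L)
    have h7 : 2 * (s₁ : ℤ) + C - r₁ ≤ |4 * g + L| := by
      nlinarith [Int.le_self_sq (2 * (s₁ : ℤ) + C - r₁)]
    have h8 : 2 * (s₂ : ℤ) + D - r₂ ≤ |4 * g + L| := by
      nlinarith [Int.le_self_sq (2 * (s₂ : ℤ) + D - r₂)]
    have h9 := neg_abs_le C
    have h10 := neg_abs_le D
    have h11 : (r₂ : ℤ) ≤ r₁ := by exact_mod_cast h1
    refine ⟨h1, ?_, ?_⟩ <;> simp only [Set.mem_Iic] <;> omega

/-- The sum `S_10(A, B | C, D)` over all `r₁, r₂, s₁, s₂ ≥ 0` of `z^(r₁)` times the terms above,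
as an element of `ℚ((q))[[z]]`. -/
noncomputable def S10 (A B C D : ℤ) : PowerSeries QLaurent :=
  PowerSeries.mk fun r₁ => (termFamily A B C D r₁).hsum

end ASW

open ASW

namespace ASW

open PowerSeries

set_option linter.unusedSimpArgs false

/-! Both sides solve the same linear $q$-difference system in $z$, and a solution of that system is
determined by one constant term.

For the series $H_c$ the system is that of Corteel and Welsh. A cylindric partition attains its
maximum $n$ as the first part of some component with $c_i\ne0$. Inclusion–exclusion over the set $J$
of such components, followed by deletion of these first parts, leaves a cylindric partition of
profile $c(J)$ with parts at most $n$, and costs the weight $n|J|$, that is, the substitution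
$z\mapsto zq^{|J|}$. After multiplication by $(zq)_\infty/(q)_\infty$ the coefficients are
polynomials in $z$ and $q$ (`H_eq_sum`). For size $7$, up to rotation, this gives twelve equations
in twelve unknowns (`profileSide_system`).

For the sums, $1/(q)_n$ satisfies $(1-q^n)/(q)_n=1/(q)_{n-1}$. Applied to the denominators of the
summand, this yields four families of contiguous relations, `S10_rel_r₁`, `S10_rel_s₁`, `S10_rel_r₂`
and `S10_rel_s₂`. Each of the twelve equations is an explicit combination of finitely many of them
with coefficients in $\mathbb{Z}[z,q]$ (`sumSide_system`).

Uniqueness is applied to the difference of the two solutions. At $z=0$ the system becomes a linear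
system over $\mathbb{Q}$ whose solutions are determined by their first entry. In degree $n\ge1$ the
right sides carry factors $q^n$, $q^{2n}$, $q^{3n}$, so a lower bound for the powers of $q$ in the
coefficients can be raised for ever, and these coefficients vanish (`CorteelWelshSystem.eq_zero`).

There remains the constant term for the profile $(7,0,0)$. It is $1/(q)_\infty$ on the left because
only the empty partition has maximum $0$. On the right a $q$-Chu–Vandermonde sum removes $s_2$, and
the Durfee rectangle expansion of $1/(q)_\infty$ is left (`coeff_zero_S10_one`,
`durfeeSeries_mul_eulerProd`). -/

/-- The monomial `q^e`. -/
noncomputable def qPow (e : ℤ) : QLaurent := HahnSeries.single e 1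

theorem qPow_add (a b : ℤ) : qPow (a + b) = qPow a * qPow b := by
  simp [qPow, HahnSeries.single_mul_single]

theorem qPow_zero : qPow 0 = 1 := rfl

theorem ofPowerSeries_X_pow (n : ℕ) :
    HahnSeries.ofPowerSeries ℤ ℚ (X ^ n) = qPow n := by
  rw [HahnSeries.ofPowerSeries_X_pow, qPow]

theorem qPow_one_pow (n : ℕ) : qPow 1 ^ n = qPow n := by
  rw [← ofPowerSeries_X_pow, map_pow, HahnSeries.ofPowerSeries_X]; rfl

theorem constantCoeff_qPoch_X (n : ℕ) :
    constantCoeff (qPoch (X : PowerSeries ℚ) X n) = 1 := by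
  simp [qPoch, map_prod]

theorem one_sub_X_pow_mul_invPoch (m : ℕ) :
    (1 - X ^ (m + 1)) * invPoch ((m : ℤ) + 1) = invPoch m := by
  have h0 : ∀ n : ℕ, invPoch n = (qPoch (X : PowerSeries ℚ) X n)⁻¹ := fun n => by
    simp [invPoch]
  have h1 : ∀ n : ℕ, qPoch (X : PowerSeries ℚ) X n * invPoch n = 1 := fun n => by
    rw [h0]; exact PowerSeries.mul_inv_cancel _ (by simp [constantCoeff_qPoch_X])
  have h2 : qPoch (X : PowerSeries ℚ) X (m + 1) = qPoch X X m * (1 - X ^ (m + 1)) := by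
    rw [qPoch, Finset.prod_range_succ, ← qPoch, pow_succ']
  have h3 := h1 (m + 1)
  rw [h2] at h3
  push_cast at h3
  linear_combination invPoch m * h3 - (1 - X ^ (m + 1)) * invPoch ((m : ℤ) + 1) * h1 m

/-- `1 / (q)_n` as a Laurent series. -/
noncomputable def invPochL (n : ℤ) : QLaurent := HahnSeries.ofPowerSeries ℤ ℚ (invPoch n)

theorem invPochL_of_neg {n : ℤ} (h : n < 0) : invPochL n = 0 := by
  simp [invPochL, invPoch, not_le.2 h]

/-- The convention $1/(q)_n=0$ for $n<0$ makes this true for every integer, since $1-q^0=0$ at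
$n=0$. The contiguous relations therefore need no boundary corrections. -/
theorem one_sub_qPow_mul_invPochL (n : ℤ) : (1 - qPow n) * invPochL n = invPochL (n - 1) := by
  rcases lt_trichotomy n 0 with h | rfl | h
  · rw [invPochL_of_neg h, invPochL_of_neg (by omega), mul_zero]
  · rw [invPochL_of_neg (n := 0 - 1) (by omega), qPow_zero, sub_self, zero_mul]
  · obtain ⟨m, rfl⟩ : ∃ m : ℕ, n = m + 1 := ⟨(n - 1).toNat, by omega⟩
    rw [add_sub_cancel_right, invPochL, invPochL, ← one_sub_X_pow_mul_invPoch, map_mul, map_sub,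
      map_one, ofPowerSeries_X_pow]
    push_cast
    rfl

/-! ### The summands of $S_{10}$ and their reindexing. -/

theorem term_eq (A B C D : ℤ) (r₁ r₂ s₁ s₂ : ℕ) :
    term A B C D r₁ r₂ s₁ s₂ = qPow (expo A B C D r₁ r₂ s₁ s₂) *
      (invPochL ((r₁ : ℤ) - r₂) * invPochL ((s₁ : ℤ) - s₂) * invPochL r₂ * invPochL s₂ *
        invPochL ((r₂ : ℤ) + s₂ + 1)) := by
  simp [term, qPow, invPochL]

theorem term_shift (A B C D a b c d : ℤ) (r₁ r₂ s₁ s₂ : ℕ) :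
    term (A + a) (B + b) (C + c) (D + d) r₁ r₂ s₁ s₂ =
      qPow (a * r₁ + b * r₂ + c * s₁ + d * s₂) * term A B C D r₁ r₂ s₁ s₂ := by
  rw [term_eq, term_eq, ← mul_assoc (qPow _) (qPow _), ← qPow_add]
  congr 2
  simp only [expo]; ring

/-- Meant for index shifts such as $s_1\mapsto s_1+1$, which are injective but not surjective on
$\mathbb{N}$; the missed indices carry zero summands. -/
theorem hsum_eq_of_injective {α β : Type*} (s : HahnSeries.SummableFamily ℤ ℚ β)
    (t : HahnSeries.SummableFamily ℤ ℚ α) (φ : α → β) (hφ : Function.Injective φ)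
    (h : ∀ a, s (φ a) = t a) (h0 : ∀ b, b ∉ Set.range φ → s b = 0) : s.hsum = t.hsum := by
  have : s = t.embDomain ⟨φ, hφ⟩ := by
    ext1 b
    by_cases hb : b ∈ Set.range φ
    · obtain ⟨a, rfl⟩ := hb
      rw [h]
      exact (HahnSeries.SummableFamily.embDomain_image (s := t) (f := ⟨φ, hφ⟩) (a := a)).symm
    · rw [h0 b hb]
      exact (HahnSeries.SummableFamily.embDomain_of_notMem_range (s := t) (f := ⟨φ, hφ⟩) hb).symm
  rw [this, HahnSeries.SummableFamily.hsum_embDomain]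

theorem hsum_eq_zero {α : Type*} (s : HahnSeries.SummableFamily ℤ ℚ α) (h : ∀ a, s a = 0) :
    s.hsum = 0 := by
  rw [show s = 0 from HahnSeries.SummableFamily.ext h, HahnSeries.SummableFamily.hsum_zero]

theorem termFamily_apply (A B C D : ℤ) (r r₂ s₁ s₂ : ℕ) :
    termFamily A B C D r (r₂, s₁, s₂) = term A B C D r r₂ s₁ s₂ := rfl

theorem coeff_S10 (A B C D : ℤ) (n : ℕ) :
    coeff n (S10 A B C D) = (termFamily A B C D n).hsum := by
  simp [S10]

theorem qVar_eq : qVar = C (qPow 1) := rfl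

theorem coeff_succ_zVar_mul_qVar_pow_mul (k n : ℕ) (f : PowerSeries QLaurent) :
    coeff (n + 1) (zVar * qVar ^ k * f) = qPow k * coeff n f := by
  rw [zVar, qVar_eq, ← map_pow, qPow_one_pow, mul_assoc, coeff_succ_X_mul, coeff_C_mul]

theorem coeff_zero_zVar_mul (f g : PowerSeries QLaurent) : coeff 0 (zVar * f * g) = 0 := by
  rw [zVar, mul_assoc, coeff_zero_X_mul]

theorem coeff_qVar_pow_mul (k n : ℕ) (f : PowerSeries QLaurent) :
    coeff n (qVar ^ k * f) = qPow k * coeff n f := by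
  rw [qVar_eq, ← map_pow, qPow_one_pow, coeff_C_mul]

theorem rescale_S10 (A B C D : ℤ) : rescale (qPow 1) (S10 A B C D) = S10 (A + 1) B C D := by
  ext1 n
  rw [coeff_rescale, coeff_S10, coeff_S10, qPow_one_pow, ← HahnSeries.SummableFamily.hsum_smul]
  congr 1
  ext1 ⟨r₂, s₁, s₂⟩
  have := term_shift A B C D 1 0 0 0 n r₂ s₁ s₂
  simp only [add_zero, zero_mul, one_mul] at this
  rw [HahnSeries.SummableFamily.smul_apply, HahnSeries.of_symm_smul_of_eq_mul, termFamily_apply,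
    termFamily_apply, this]

/-! ### Contiguous relations for $S_{10}$. -/

theorem smul_summableFamily_apply {α : Type*} (x : QLaurent)
    (s : HahnSeries.SummableFamily ℤ ℚ α) (p : α) : (x • s) p = x * s p := by
  rw [HahnSeries.SummableFamily.smul_apply, HahnSeries.of_symm_smul_of_eq_mul]

/-- The factor $1-q^{r_1-r_2}$ lowers $(q)_{r_1-r_2}$, and $r_1\mapsto r_1+1$ restores it. The shift
leaves $zq^{1+A}$ outside; `k` is this exponent as a natural number. -/
theorem S10_rel_r₁ (A B C D : ℤ) (k : ℕ) (hk : 1 + A = k) :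
    S10 A B C D = S10 (A + 1) (B - 1) C D + zVar * qVar ^ k * S10 (A + 2) B (C - 1) D := by
  rw [← sub_eq_iff_eq_add']
  ext1 n
  rw [map_sub, coeff_S10, coeff_S10, ← HahnSeries.SummableFamily.hsum_sub]
  have h1 : ∀ n r₂ s₁ s₂ : ℕ, term A B C D n r₂ s₁ s₂ - term (A + 1) (B - 1) C D n r₂ s₁ s₂ =
      qPow (expo A B C D n r₂ s₁ s₂) *
      (invPochL ((n : ℤ) - r₂ - 1) * invPochL ((s₁ : ℤ) - s₂) * invPochL r₂ * invPochL s₂ *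
        invPochL ((r₂ : ℤ) + s₂ + 1)) := fun n r₂ s₁ s₂ => by
    have h := term_shift A B C D 1 (-1) 0 0 n r₂ s₁ s₂
    simp only [add_zero, ← sub_eq_add_neg, zero_mul, one_mul, neg_mul] at h
    rw [h, term_eq, ← one_sub_qPow_mul_invPochL]
    ring
  rcases n with _ | n
  · rw [coeff_zero_zVar_mul]
    refine hsum_eq_zero _ ?_
    rintro ⟨r₂, s₁, s₂⟩
    rw [HahnSeries.SummableFamily.sub_apply, termFamily_apply, termFamily_apply, h1,
      invPochL_of_neg (by push_cast; omega)]
    simp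
  · rw [coeff_succ_zVar_mul_qVar_pow_mul, coeff_S10, ← HahnSeries.SummableFamily.hsum_smul]
    congr 1
    ext1 ⟨r₂, s₁, s₂⟩
    rw [HahnSeries.SummableFamily.sub_apply, termFamily_apply, termFamily_apply, h1,
      smul_summableFamily_apply, termFamily_apply, term_eq, ← mul_assoc (qPow _) (qPow _), ← qPow_add]
    congr 2
    · simp only [expo, ← hk]; push_cast; ring
    · congr 4; push_cast; ring

/-- The same mechanism with $1-q^{s_1-s_2}$ and $s_1\mapsto s_1+1$. No $z$ appears because its
exponent is $r_1$. -/
theorem S10_rel_s₁ (A B C D : ℤ) (k : ℕ) (hk : 1 + C = k) :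
    S10 A B C D = S10 A B (C + 1) (D - 1) + qVar ^ k * S10 (A - 1) B (C + 2) D := by
  rw [← sub_eq_iff_eq_add']
  ext1 n
  rw [map_sub, coeff_S10, coeff_S10, ← HahnSeries.SummableFamily.hsum_sub, coeff_qVar_pow_mul,
    coeff_S10, ← HahnSeries.SummableFamily.hsum_smul]
  have h1 : ∀ r₂ s₁ s₂ : ℕ, term A B C D n r₂ s₁ s₂ - term A B (C + 1) (D - 1) n r₂ s₁ s₂ =
      qPow (expo A B C D n r₂ s₁ s₂) *
      (invPochL ((n : ℤ) - r₂) * invPochL ((s₁ : ℤ) - s₂ - 1) * invPochL r₂ * invPochL s₂ *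
        invPochL ((r₂ : ℤ) + s₂ + 1)) := fun r₂ s₁ s₂ => by
    have h := term_shift A B C D 0 0 1 (-1) n r₂ s₁ s₂
    simp only [add_zero, zero_add, ← sub_eq_add_neg, zero_mul, one_mul, neg_mul] at h
    rw [h, term_eq, ← one_sub_qPow_mul_invPochL]
    ring
  refine hsum_eq_of_injective _ _ (fun p => (p.1, p.2.1 + 1, p.2.2)) ?_ ?_ ?_
  · rintro ⟨a, b, c⟩ ⟨a', b', c'⟩ h
    simpa using h
  · rintro ⟨r₂, s₁, s₂⟩
    rw [HahnSeries.SummableFamily.sub_apply, termFamily_apply, termFamily_apply, h1,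
      smul_summableFamily_apply, termFamily_apply, term_eq, ← mul_assoc (qPow _) (qPow _), ← qPow_add]
    congr 2
    · simp only [expo, ← hk]; push_cast; ring
    · congr 4; push_cast; ring
  · rintro ⟨r₂, _ | s₁, s₂⟩ h
    · rw [HahnSeries.SummableFamily.sub_apply, termFamily_apply, termFamily_apply, h1,
        invPochL_of_neg (n := _ - 1) (by push_cast; omega)]
      simp
    · exact absurd ⟨(r₂, s₁, s₂), rfl⟩ h

/-- The factor $(1-q^{r_2})(1-q^{r_2+s_2+1})$ lowers two denominators at once. Shifting $r_1$ and
$r_2$ together restores both and keeps $r_1-r_2$ fixed. -/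
theorem S10_rel_r₂ (A B C D : ℤ) (k : ℕ) (hk : 2 + A + B = k) :
    S10 A B C D = S10 A (B + 1) C D + qVar * S10 A (B + 1) C (D + 1)
      - qVar * S10 A (B + 2) C (D + 1) + zVar * qVar ^ k * S10 (A + 2) (B + 2) (C - 1) (D - 1) := by
  have h1 : ∀ n r₂ s₁ s₂ : ℕ, term A B C D n r₂ s₁ s₂ - term A (B + 1) C D n r₂ s₁ s₂
      - qPow 1 * term A (B + 1) C (D + 1) n r₂ s₁ s₂
      + qPow 1 * term A (B + 2) C (D + 1) n r₂ s₁ s₂ =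
      qPow (expo A B C D n r₂ s₁ s₂) *
      (invPochL ((n : ℤ) - r₂) * invPochL ((s₁ : ℤ) - s₂) * invPochL ((r₂ : ℤ) - 1) *
        invPochL s₂ * invPochL ((r₂ : ℤ) + s₂ + 1 - 1)) := fun n r₂ s₁ s₂ => by
    have e1 := term_shift A B C D 0 1 0 0 n r₂ s₁ s₂
    have e2 := term_shift A B C D 0 1 0 1 n r₂ s₁ s₂
    have e3 := term_shift A B C D 0 2 0 1 n r₂ s₁ s₂
    simp only [add_zero, zero_add, zero_mul, one_mul] at e1 e2 e3
    rw [e1, e2, e3, term_eq, ← one_sub_qPow_mul_invPochL, ← one_sub_qPow_mul_invPochL, two_mul]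
    simp only [qPow_add]
    ring
  have h2 : S10 A B C D - S10 A (B + 1) C D - qVar ^ 1 * S10 A (B + 1) C (D + 1)
      + qVar ^ 1 * S10 A (B + 2) C (D + 1)
      = zVar * qVar ^ k * S10 (A + 2) (B + 2) (C - 1) (D - 1) := by
    ext1 n
    simp only [map_sub, map_add, coeff_qVar_pow_mul, coeff_S10,
      ← HahnSeries.SummableFamily.hsum_smul, ← HahnSeries.SummableFamily.hsum_sub,
      ← HahnSeries.SummableFamily.hsum_add]
    rcases n with _ | n
    · rw [coeff_zero_zVar_mul]
      refine hsum_eq_zero _ ?_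
      rintro ⟨r₂, s₁, s₂⟩
      simp only [HahnSeries.SummableFamily.sub_apply, HahnSeries.SummableFamily.add_apply,
        smul_summableFamily_apply, termFamily_apply]
      rw [Nat.cast_one, h1]
      -- In degree $0$ in $z$ everything vanishes: $r_2=0$ through $1/(q)_{r_2-1}$, and $r_2>0$
      -- through $1/(q)_{0-r_2}$.
      rcases r₂ with _ | r₂
      · rw [invPochL_of_neg (n := _ - 1) (by norm_num)]
        simp
      · rw [invPochL_of_neg (n := _ - _) (by push_cast; omega)]
        simp
    · rw [coeff_succ_zVar_mul_qVar_pow_mul, coeff_S10, ← HahnSeries.SummableFamily.hsum_smul]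
      refine hsum_eq_of_injective _ _ (fun p => (p.1 + 1, p.2.1, p.2.2)) ?_ ?_ ?_
      · rintro ⟨a, b, c⟩ ⟨a', b', c'⟩ h
        simpa using h
      · rintro ⟨r₂, s₁, s₂⟩
        simp only [HahnSeries.SummableFamily.sub_apply, HahnSeries.SummableFamily.add_apply,
          smul_summableFamily_apply, termFamily_apply]
        rw [Nat.cast_one, h1, term_eq, ← mul_assoc (qPow _) (qPow _), ← qPow_add]
        congr 2
        · simp only [expo, ← hk]; push_cast; ring
        · congr 4 <;> push_cast <;> ring
        · push_cast; ring_nf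
      · rintro ⟨_ | r₂, s₁, s₂⟩ h
        · simp only [HahnSeries.SummableFamily.sub_apply, HahnSeries.SummableFamily.add_apply,
            smul_summableFamily_apply, termFamily_apply]
          rw [Nat.cast_one, h1, invPochL_of_neg (n := _ - 1) (by norm_num)]
          simp
        · exact absurd ⟨(r₂, s₁, s₂), rfl⟩ h
  rw [pow_one] at h2
  linear_combination h2

/-- The factor $(1-q^{s_2})(1-q^{r_2+s_2+1})$ plays the same role, now with $s_1$ and $s_2$ shifted
together. -/
theorem S10_rel_s₂ (A B C D : ℤ) (k : ℕ) (hk : 2 + C + D = k) :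
    S10 A B C D = S10 A B C (D + 1) + qVar * S10 A (B + 1) C (D + 1)
      - qVar * S10 A (B + 1) C (D + 2) + qVar ^ k * S10 (A - 1) (B - 1) (C + 2) (D + 2) := by
  have h1 : ∀ n r₂ s₁ s₂ : ℕ, term A B C D n r₂ s₁ s₂ - term A B C (D + 1) n r₂ s₁ s₂
      - qPow 1 * term A (B + 1) C (D + 1) n r₂ s₁ s₂
      + qPow 1 * term A (B + 1) C (D + 2) n r₂ s₁ s₂ =
      qPow (expo A B C D n r₂ s₁ s₂) *
      (invPochL ((n : ℤ) - r₂) * invPochL ((s₁ : ℤ) - s₂) * invPochL r₂ *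
        invPochL ((s₂ : ℤ) - 1) * invPochL ((r₂ : ℤ) + s₂ + 1 - 1)) := fun n r₂ s₁ s₂ => by
    have e1 := term_shift A B C D 0 0 0 1 n r₂ s₁ s₂
    have e2 := term_shift A B C D 0 1 0 1 n r₂ s₁ s₂
    have e3 := term_shift A B C D 0 1 0 2 n r₂ s₁ s₂
    simp only [add_zero, zero_add, zero_mul, one_mul] at e1 e2 e3
    rw [e1, e2, e3, term_eq, ← one_sub_qPow_mul_invPochL, ← one_sub_qPow_mul_invPochL, two_mul]
    simp only [qPow_add]
    ring
  have h2 : S10 A B C D - S10 A B C (D + 1) - qVar ^ 1 * S10 A (B + 1) C (D + 1)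
      + qVar ^ 1 * S10 A (B + 1) C (D + 2)
      = qVar ^ k * S10 (A - 1) (B - 1) (C + 2) (D + 2) := by
    ext1 n
    simp only [map_sub, map_add, coeff_qVar_pow_mul, coeff_S10,
      ← HahnSeries.SummableFamily.hsum_smul, ← HahnSeries.SummableFamily.hsum_sub,
      ← HahnSeries.SummableFamily.hsum_add]
    refine hsum_eq_of_injective _ _ (fun p => (p.1, p.2.1 + 1, p.2.2 + 1)) ?_ ?_ ?_
    · rintro ⟨a, b, c⟩ ⟨a', b', c'⟩ h
      simpa using h
    · rintro ⟨r₂, s₁, s₂⟩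
      simp only [HahnSeries.SummableFamily.sub_apply, HahnSeries.SummableFamily.add_apply,
        smul_summableFamily_apply, termFamily_apply]
      rw [Nat.cast_one, h1, term_eq, ← mul_assoc (qPow _) (qPow _), ← qPow_add]
      congr 2
      · simp only [expo, ← hk]; push_cast; ring
      · congr 2 <;> push_cast <;> ring_nf
      · push_cast; ring_nf
    · rintro ⟨r₂, s₁, s₂⟩ h
      simp only [HahnSeries.SummableFamily.sub_apply, HahnSeries.SummableFamily.add_apply,
        smul_summableFamily_apply, termFamily_apply]
      rw [Nat.cast_one, h1]
      rcases s₂ with _ | s₂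
      · rw [invPochL_of_neg (n := _ - 1) (by norm_num)]
        simp
      · rcases s₁ with _ | s₁
        · rw [invPochL_of_neg (n := ((0 : ℕ) : ℤ) - _) (by push_cast; omega)]
          simp
        · exact absurd ⟨(r₂, s₁, s₂), rfl⟩ h
  rw [pow_one] at h2
  linear_combination h2

/-! ### The $q$-difference system. -/

/-- The substitution `z ↦ z q^k`. -/
noncomputable def zShift (k : ℕ) : PowerSeries QLaurent →+* PowerSeries QLaurent :=
  rescale (qPow k)

theorem zShift_S10 (k : ℕ) (A B C D : ℤ) : zShift k (S10 A B C D) = S10 (A + k) B C D := by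
  induction k with
  | zero => simp [zShift, qPow_zero]
  | succ k ih =>
    have h : zShift (k + 1) (S10 A B C D) = rescale (qPow 1) (zShift k (S10 A B C D)) := by
      rw [zShift, zShift, rescale_rescale, ← qPow_add, Nat.cast_succ]
    rw [h, ih, rescale_S10]
    push_cast
    rw [add_assoc]

theorem zShift_qVar (k : ℕ) : zShift k qVar = qVar := by
  ext1 n
  rw [zShift, coeff_rescale, qVar_eq, coeff_C]
  split_ifs with h <;> simp [h]

theorem zShift_zVar (k : ℕ) : zShift k zVar = zVar * qVar ^ k := by
  rw [zShift, zVar, rescale_X, qVar_eq, ← map_pow, qPow_one_pow, mul_comm]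

/-- The `q`-difference equations satisfied by the twelve series `H_c`, where `c` runs over the
profiles of size `7` up to rotation. -/
structure CorteelWelshSystem (h : Fin 12 → PowerSeries QLaurent) : Prop where
  eq_700 : h 0 = zShift 1 (h 1)
  eq_610 : h 1 = zShift 1 (h 2) + zShift 1 (h 6)
       - (1 - zVar * qVar) * zShift 2 (h 3)
  eq_520 : h 2 = zShift 1 (h 9) + zShift 1 (h 3)
       - (1 - zVar * qVar) * zShift 2 (h 4)
  eq_511 : h 3 = zShift 1 (h 4) + zShift 1 (h 7) + zShift 1 (h 1)
       - (1 - zVar * qVar) * (zShift 2 (h 8) + zShift 2 (h 2) + zShift 2 (h 6))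
       + (1 - zVar * qVar) * (1 - zVar * qVar ^ 2) * zShift 3 (h 3)
  eq_421 : h 4 = zShift 1 (h 10) + zShift 1 (h 8) + zShift 1 (h 2)
       - (1 - zVar * qVar) * (zShift 2 (h 5) + zShift 2 (h 9) + zShift 2 (h 3))
       + (1 - zVar * qVar) * (1 - zVar * qVar ^ 2) * zShift 3 (h 4)
  eq_322 : h 5 = zShift 1 (h 5) + zShift 1 (h 10) + zShift 1 (h 4)
       - (1 - zVar * qVar) * (zShift 2 (h 5) + zShift 2 (h 10) + zShift 2 (h 8))
       + (1 - zVar * qVar) * (1 - zVar * qVar ^ 2) * zShift 3 (h 5)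
  eq_601 : h 6 = zShift 1 (h 3) + zShift 1 (h 0)
       - (1 - zVar * qVar) * zShift 2 (h 1)
  eq_502 : h 7 = zShift 1 (h 8) + zShift 1 (h 6)
       - (1 - zVar * qVar) * zShift 2 (h 3)
  eq_412 : h 8 = zShift 1 (h 5) + zShift 1 (h 11) + zShift 1 (h 3)
       - (1 - zVar * qVar) * (zShift 2 (h 10) + zShift 2 (h 4) + zShift 2 (h 7))
       + (1 - zVar * qVar) * (1 - zVar * qVar ^ 2) * zShift 3 (h 8)
  eq_430 : h 9 = zShift 1 (h 11) + zShift 1 (h 4)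
       - (1 - zVar * qVar) * zShift 2 (h 10)
  eq_331 : h 10 = zShift 1 (h 8) + zShift 1 (h 5) + zShift 1 (h 9)
       - (1 - zVar * qVar) * (zShift 2 (h 5) + zShift 2 (h 11) + zShift 2 (h 4))
       + (1 - zVar * qVar) * (1 - zVar * qVar ^ 2) * zShift 3 (h 10)
  eq_403 : h 11 = zShift 1 (h 10) + zShift 1 (h 7)
       - (1 - zVar * qVar) * zShift 2 (h 8)

/-! ### The sums solve the system. -/

/-- The twelve combinations of the sums `S_10`. -/
noncomputable def sumSide : Fin 12 → PowerSeries QLaurent :=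
  ![S10 1 1 1 1,
    S10 0 1 1 1,
    S10 0 0 1 1,
    S10 0 1 0 1 - qVar * S10 1 1 1 1,
    S10 0 0 0 1 - qVar * S10 0 1 1 1,
    S10 0 0 0 0 - qVar * S10 0 1 0 1,
    S10 1 1 0 1 - qVar * (1 - zVar) * S10 2 1 1 1,
    S10 1 1 0 0 - qVar * (1 - zVar) * S10 2 1 0 1,
    S10 0 1 0 0 - qVar * S10 1 1 0 1,
    S10 (-1) 0 1 1 - S10 0 1 0 1 + (1 - zVar) * S10 1 0 0 1 + zVar * qVar * S10 1 1 1 1,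
    S10 (-1) 0 0 1 - S10 0 1 0 0 + (1 - zVar) * S10 1 0 0 0 + zVar * qVar * S10 1 1 0 1
        - qVar * S10 (-1) 1 1 1 - zVar * S10 0 0 1 1,
    S10 0 0 0 1 - qVar * S10 0 1 1 1 - zVar * qVar * S10 1 0 1 1 - S10 1 1 0 0
        + (1 - qVar * zVar) * S10 2 0 0 0 + zVar * qVar ^ 2 * S10 2 1 0 1
        + zVar * qVar * S10 2 1 0 0]

theorem sumSide_700 : sumSide 0 =
      S10 1 1 1 1 := rfl

theorem sumSide_610 : sumSide 1 =
      S10 0 1 1 1 := rfl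

theorem sumSide_520 : sumSide 2 =
      S10 0 0 1 1 := rfl

theorem sumSide_511 : sumSide 3 =
      S10 0 1 0 1 - qVar * S10 1 1 1 1 := rfl

theorem sumSide_421 : sumSide 4 =
      S10 0 0 0 1 - qVar * S10 0 1 1 1 := rfl

theorem sumSide_322 : sumSide 5 =
      S10 0 0 0 0 - qVar * S10 0 1 0 1 := rfl

theorem sumSide_601 : sumSide 6 =
      S10 1 1 0 1 - qVar * (1 - zVar) * S10 2 1 1 1 := rfl

theorem sumSide_502 : sumSide 7 =
      S10 1 1 0 0 - qVar * (1 - zVar) * S10 2 1 0 1 := rfl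

theorem sumSide_412 : sumSide 8 =
      S10 0 1 0 0 - qVar * S10 1 1 0 1 := rfl

theorem sumSide_430 : sumSide 9 =
      S10 (-1) 0 1 1 - S10 0 1 0 1 + (1 - zVar) * S10 1 0 0 1 + zVar * qVar * S10 1 1 1 1 := rfl

theorem sumSide_331 : sumSide 10 =
      S10 (-1) 0 0 1 - S10 0 1 0 0 + (1 - zVar) * S10 1 0 0 0 + zVar * qVar * S10 1 1 0 1
        - qVar * S10 (-1) 1 1 1 - zVar * S10 0 0 1 1 := rfl

theorem sumSide_403 : sumSide 11 =
      S10 0 0 0 1 - qVar * S10 0 1 1 1 - zVar * qVar * S10 1 0 1 1 - S10 1 1 0 0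
        + (1 - qVar * zVar) * S10 2 0 0 0 + zVar * qVar ^ 2 * S10 2 1 0 1
        + zVar * qVar * S10 2 1 0 0 := rfl

/-- The equations for 700, 520, 421, 601, 502 and 403 only express the entries 700, 430, 331, 601,
502 and 403 through the other six, up to $z\mapsto zq$. They hold identically in the symbols
$S_{10}$; the remaining six equations need the contiguous relations. -/
theorem sumSide_700_eq :
    sumSide 0 = zShift 1 (sumSide 1) := by
  simp only [sumSide_700, sumSide_610, map_sub, map_add, map_mul, map_pow,
    map_one, zShift_S10, zShift_qVar, zShift_zVar, Nat.cast_one, Nat.cast_ofNat, Int.reduceAdd,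
    Int.reduceNeg]

theorem sumSide_610_eq :
    sumSide 1 = zShift 1 (sumSide 2) + zShift 1 (sumSide 6)
       - (1 - zVar * qVar) * zShift 2 (sumSide 3) := by
  simp only [sumSide_610, sumSide_520, sumSide_511, sumSide_601, map_sub, map_add, map_mul, map_pow,
    map_one, zShift_S10, zShift_qVar, zShift_zVar, Nat.cast_one, Nat.cast_ofNat, Int.reduceAdd,
    Int.reduceNeg]
  have h1 := S10_rel_r₁ 0 1 1 1 1 rfl
  simp only [Int.reduceAdd, Int.reduceSub, Int.reduceNeg] at *
  linear_combination 1 * h1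

theorem sumSide_520_eq :
    sumSide 2 = zShift 1 (sumSide 9) + zShift 1 (sumSide 3)
       - (1 - zVar * qVar) * zShift 2 (sumSide 4) := by
  simp only [sumSide_520, sumSide_511, sumSide_421, sumSide_430, map_sub, map_add, map_mul, map_pow,
    map_one, zShift_S10, zShift_qVar, zShift_zVar, Nat.cast_one, Nat.cast_ofNat, Int.reduceAdd,
    Int.reduceNeg]
  ring

theorem sumSide_511_eq :
    sumSide 3 = zShift 1 (sumSide 4) + zShift 1 (sumSide 7) + zShift 1 (sumSide 1)
       - (1 - zVar * qVar) * (zShift 2 (sumSide 8) + zShift 2 (sumSide 2) + zShift 2 (sumSide 6))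
       + (1 - zVar * qVar) * (1 - zVar * qVar ^ 2) * zShift 3 (sumSide 3) := by
  simp only [sumSide_610, sumSide_520, sumSide_511, sumSide_421, sumSide_601, sumSide_502, sumSide_412, map_sub, map_add, map_mul, map_pow,
    map_one, zShift_S10, zShift_qVar, zShift_zVar, Nat.cast_one, Nat.cast_ofNat, Int.reduceAdd,
    Int.reduceNeg]
  have h1 := S10_rel_r₁ (-1) 1 2 1 0 rfl
  have h2 := S10_rel_r₁ 0 1 1 0 1 rfl
  have h3 := S10_rel_r₁ 1 1 1 1 2 rfl
  have h4 := S10_rel_s₁ 0 1 0 1 1 rfl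
  have h5 := S10_rel_s₁ 1 0 0 1 1 rfl
  simp only [Int.reduceAdd, Int.reduceSub, Int.reduceNeg] at *
  linear_combination qVar * h1 + 1 * h2 + (-1 + zVar * qVar) * h3 + 1 * h4 + (-1) * h5

theorem sumSide_421_eq :
    sumSide 4 = zShift 1 (sumSide 10) + zShift 1 (sumSide 8) + zShift 1 (sumSide 2)
       - (1 - zVar * qVar) * (zShift 2 (sumSide 5) + zShift 2 (sumSide 9) + zShift 2 (sumSide 3))
       + (1 - zVar * qVar) * (1 - zVar * qVar ^ 2) * zShift 3 (sumSide 4) := by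
  simp only [sumSide_520, sumSide_511, sumSide_421, sumSide_322, sumSide_412, sumSide_430, sumSide_331, map_sub, map_add, map_mul, map_pow,
    map_one, zShift_S10, zShift_qVar, zShift_zVar, Nat.cast_one, Nat.cast_ofNat, Int.reduceAdd,
    Int.reduceNeg]
  ring

theorem sumSide_322_eq :
    sumSide 5 = zShift 1 (sumSide 5) + zShift 1 (sumSide 10) + zShift 1 (sumSide 4)
       - (1 - zVar * qVar) * (zShift 2 (sumSide 5) + zShift 2 (sumSide 10) + zShift 2 (sumSide 8))
       + (1 - zVar * qVar) * (1 - zVar * qVar ^ 2) * zShift 3 (sumSide 5) := by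
  simp only [sumSide_421, sumSide_322, sumSide_412, sumSide_331, map_sub, map_add, map_mul, map_pow,
    map_one, zShift_S10, zShift_qVar, zShift_zVar, Nat.cast_one, Nat.cast_ofNat, Int.reduceAdd,
    Int.reduceNeg]
  have h1 := S10_rel_r₁ 0 0 0 0 1 rfl
  have h2 := S10_rel_r₁ 0 0 0 1 1 rfl
  have h3 := S10_rel_r₁ 0 0 2 1 1 rfl
  have h4 := S10_rel_r₁ 0 0 2 2 1 rfl
  have h5 := S10_rel_r₁ 0 1 0 1 1 rfl
  have h6 := S10_rel_r₁ 0 1 1 1 1 rfl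
  have h7 := S10_rel_r₁ 1 1 0 0 2 rfl
  have h8 := S10_rel_r₁ 1 1 0 1 2 rfl
  have h9 := S10_rel_r₁ 1 2 0 2 2 rfl
  have h10 := S10_rel_s₁ 1 0 0 1 1 rfl
  have h11 := S10_rel_s₁ 1 0 0 2 1 rfl
  have h12 := S10_rel_s₁ 2 0 (-1) 0 0 rfl
  have h13 := S10_rel_s₁ 2 0 (-1) 1 0 rfl
  have h14 := S10_rel_s₁ 2 1 (-1) 1 0 rfl
  have h15 := S10_rel_r₂ 1 (-1) 0 0 2 rfl
  have h16 := S10_rel_r₂ 1 (-1) 0 1 2 rfl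
  have h17 := S10_rel_r₂ 1 0 0 1 3 rfl
  have h18 := S10_rel_s₂ 2 0 0 (-1) 1 rfl
  have h19 := S10_rel_s₂ 2 0 0 0 2 rfl
  have h20 := S10_rel_s₂ 3 1 (-1) (-1) 0 rfl
  have h21 := S10_rel_s₂ 3 1 (-1) 0 1 rfl
  simp only [Int.reduceAdd, Int.reduceSub, Int.reduceNeg] at *
  -- With the parameters reduced to numerals, the distinct $S_{10}$ are independent atoms, and the
  -- weights are a certificate over $\mathbb{Z}[z,q]$.
  linear_combination 1 * h1 + (-1) * h2 + (-zVar * qVar ^ 2) * h3 + (-qVar ^ 2) * h4 + (-qVar) * h5 + qVar * h6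
    + 1 * h7 + (-1) * h8 + qVar * h9 + (-zVar * qVar) * h10 + (-qVar) * h11 + zVar * qVar *
    h12 + (-zVar * qVar) * h13 + (-zVar * qVar ^ 2) * h14 + 1 * h15 + (-1) * h16 + (-1) * h17
    + zVar * qVar * h18 + 1 * h19 + zVar * qVar ^ 2 * h20 + zVar * qVar ^ 2 * h21

theorem sumSide_601_eq :
    sumSide 6 = zShift 1 (sumSide 3) + zShift 1 (sumSide 0)
       - (1 - zVar * qVar) * zShift 2 (sumSide 1) := by
  simp only [sumSide_700, sumSide_610, sumSide_511, sumSide_601, map_sub, map_add, map_mul, map_pow,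
    map_one, zShift_S10, zShift_qVar, zShift_zVar, Nat.cast_one, Nat.cast_ofNat, Int.reduceAdd,
    Int.reduceNeg]
  ring

theorem sumSide_502_eq :
    sumSide 7 = zShift 1 (sumSide 8) + zShift 1 (sumSide 6)
       - (1 - zVar * qVar) * zShift 2 (sumSide 3) := by
  simp only [sumSide_511, sumSide_601, sumSide_502, sumSide_412, map_sub, map_add, map_mul, map_pow,
    map_one, zShift_S10, zShift_qVar, zShift_zVar, Nat.cast_one, Nat.cast_ofNat, Int.reduceAdd,
    Int.reduceNeg]
  ring

theorem sumSide_412_eq :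
    sumSide 8 = zShift 1 (sumSide 5) + zShift 1 (sumSide 11) + zShift 1 (sumSide 3)
       - (1 - zVar * qVar) * (zShift 2 (sumSide 10) + zShift 2 (sumSide 4) + zShift 2 (sumSide 7))
       + (1 - zVar * qVar) * (1 - zVar * qVar ^ 2) * zShift 3 (sumSide 8) := by
  simp only [sumSide_511, sumSide_421, sumSide_322, sumSide_502, sumSide_412, sumSide_331, sumSide_403, map_sub, map_add, map_mul, map_pow,
    map_one, zShift_S10, zShift_qVar, zShift_zVar, Nat.cast_one, Nat.cast_ofNat, Int.reduceAdd,
    Int.reduceNeg]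
  have h1 := S10_rel_r₁ 0 1 0 0 1 rfl
  have h2 := S10_rel_r₁ 0 1 2 1 1 rfl
  have h3 := S10_rel_r₁ 1 0 0 1 2 rfl
  have h4 := S10_rel_r₁ 1 1 1 0 2 rfl
  have h5 := S10_rel_r₁ 1 1 1 1 2 rfl
  have h6 := S10_rel_r₁ 2 1 0 0 3 rfl
  have h7 := S10_rel_r₁ 2 2 0 0 3 rfl
  have h8 := S10_rel_s₁ 1 0 1 2 2 rfl
  have h9 := S10_rel_s₁ 1 1 0 1 1 rfl
  have h10 := S10_rel_s₁ 2 0 0 1 1 rfl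
  have h11 := S10_rel_s₁ 2 0 0 2 1 rfl
  have h12 := S10_rel_s₁ 2 1 (-1) 1 0 rfl
  have h13 := S10_rel_s₁ 2 2 (-1) 1 0 rfl
  have h14 := S10_rel_s₁ 2 2 (-1) 2 0 rfl
  have h15 := S10_rel_s₁ 3 0 (-1) 1 0 rfl
  have h16 := S10_rel_r₂ 2 (-1) 0 1 3 rfl
  have h17 := S10_rel_r₂ 2 0 0 1 4 rfl
  have h18 := S10_rel_s₂ 1 1 1 0 3 rfl
  have h19 := S10_rel_s₂ 2 1 (-1) 0 1 rfl
  have h20 := S10_rel_s₂ 2 1 0 0 2 rfl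
  simp only [Int.reduceAdd, Int.reduceSub, Int.reduceNeg] at *
  linear_combination 1 * h1 + (-qVar) * h2 + (-zVar * qVar) * h3 + (-1 + zVar * qVar) * h4 + zVar * qVar ^ 2 *
    h5 + zVar * qVar * h6 + zVar * qVar ^ 2 * h7 + zVar * qVar ^ 2 * h8 + (-1) * h9 + (1 -
    zVar * qVar) * h10 + (-zVar * qVar ^ 2) * h11 + zVar * qVar * h12 + zVar * qVar ^ 2 * h13
    + (-zVar * qVar ^ 2) * h14 + (-zVar ^ 2 * qVar ^ 3) * h15 + (-zVar * qVar) * h16 + (-zVar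
    * qVar) * h17 + (-zVar * qVar) * h18 + zVar * qVar * h19 + zVar * qVar * h20

theorem sumSide_430_eq :
    sumSide 9 = zShift 1 (sumSide 11) + zShift 1 (sumSide 4)
       - (1 - zVar * qVar) * zShift 2 (sumSide 10) := by
  simp only [sumSide_421, sumSide_430, sumSide_331, sumSide_403, map_sub, map_add, map_mul, map_pow,
    map_one, zShift_S10, zShift_qVar, zShift_zVar, Nat.cast_one, Nat.cast_ofNat, Int.reduceAdd,
    Int.reduceNeg]
  have h1 := S10_rel_r₁ (-1) 0 1 1 0 rfl
  have h2 := S10_rel_r₁ (-1) 0 3 2 0 rfl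
  have h3 := S10_rel_r₁ (-1) 1 2 1 0 rfl
  have h4 := S10_rel_r₁ 0 0 1 1 1 rfl
  have h5 := S10_rel_r₁ 0 1 1 0 1 rfl
  have h6 := S10_rel_r₁ 0 1 1 2 1 rfl
  have h7 := S10_rel_r₁ 1 0 0 1 2 rfl
  have h8 := S10_rel_r₁ 1 1 1 1 2 rfl
  have h9 := S10_rel_r₁ 2 1 0 0 3 rfl
  have h10 := S10_rel_s₁ 0 0 1 2 2 rfl
  have h11 := S10_rel_s₁ 0 1 0 1 1 rfl
  have h12 := S10_rel_s₁ 2 0 0 2 1 rfl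
  have h13 := S10_rel_s₁ 3 0 (-1) 1 0 rfl
  have h14 := S10_rel_r₂ 0 (-1) 1 1 1 rfl
  have h15 := S10_rel_r₂ 1 (-1) 1 1 2 rfl
  have h16 := S10_rel_r₂ 2 (-1) 0 1 3 rfl
  have h17 := S10_rel_s₂ 1 0 1 0 3 rfl
  simp only [Int.reduceAdd, Int.reduceSub, Int.reduceNeg] at *
  linear_combination 1 * h1 + qVar ^ 3 * h2 + (-qVar) * h3 + 1 * h4 + (-1) * h5 + (-qVar) * h6 + (-zVar * qVar)
    * h7 + zVar * qVar ^ 2 * h8 + zVar * qVar * h9 + qVar * h10 + (-1) * h11 + (-zVar * qVar ^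
    2) * h12 + (-zVar ^ 2 * qVar ^ 3) * h13 + 1 * h14 + 1 * h15 + (-zVar * qVar) * h16 + (-1)
    * h17

theorem sumSide_331_eq :
    sumSide 10 = zShift 1 (sumSide 8) + zShift 1 (sumSide 5) + zShift 1 (sumSide 9)
       - (1 - zVar * qVar) * (zShift 2 (sumSide 5) + zShift 2 (sumSide 11) + zShift 2 (sumSide 4))
       + (1 - zVar * qVar) * (1 - zVar * qVar ^ 2) * zShift 3 (sumSide 10) := by
  simp only [sumSide_421, sumSide_322, sumSide_412, sumSide_430, sumSide_331, sumSide_403, map_sub, map_add, map_mul, map_pow,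
    map_one, zShift_S10, zShift_qVar, zShift_zVar, Nat.cast_one, Nat.cast_ofNat, Int.reduceAdd,
    Int.reduceNeg]
  have h1 := S10_rel_r₁ (-1) 0 0 1 0 rfl
  have h2 := S10_rel_r₁ (-1) 1 1 1 0 rfl
  have h3 := S10_rel_r₁ 0 0 0 1 1 rfl
  have h4 := S10_rel_r₁ 0 0 1 1 1 rfl
  have h5 := S10_rel_r₁ 0 0 3 2 1 rfl
  have h6 := S10_rel_r₁ 0 1 0 1 1 rfl
  have h7 := S10_rel_r₁ 0 1 0 2 1 rfl
  have h8 := S10_rel_r₁ 0 1 2 1 1 rfl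
  have h9 := S10_rel_r₁ 0 2 0 1 1 rfl
  have h10 := S10_rel_r₁ 0 2 0 2 1 rfl
  have h11 := S10_rel_r₁ 1 0 1 1 2 rfl
  have h12 := S10_rel_r₁ 1 1 0 0 2 rfl
  have h13 := S10_rel_r₁ 1 1 1 0 2 rfl
  have h14 := S10_rel_r₁ 1 1 1 2 2 rfl
  have h15 := S10_rel_r₁ 2 0 0 1 3 rfl
  have h16 := S10_rel_r₁ 2 1 1 1 3 rfl
  have h17 := S10_rel_r₁ 3 1 0 0 4 rfl
  have h18 := S10_rel_s₁ 0 0 0 2 1 rfl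
  have h19 := S10_rel_s₁ 1 0 (-1) 1 0 rfl
  have h20 := S10_rel_s₁ 1 0 1 2 2 rfl
  have h21 := S10_rel_s₁ 1 1 0 1 1 rfl
  have h22 := S10_rel_s₁ 2 0 (-1) 1 0 rfl
  have h23 := S10_rel_s₁ 2 0 0 1 1 rfl
  have h24 := S10_rel_s₁ 2 1 (-1) 2 0 rfl
  have h25 := S10_rel_s₁ 3 0 0 2 1 rfl
  have h26 := S10_rel_s₁ 4 0 (-1) 1 0 rfl
  have h27 := S10_rel_r₂ 0 (-1) 0 1 1 rfl
  have h28 := S10_rel_r₂ 1 (-1) 0 1 2 rfl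
  have h29 := S10_rel_r₂ 1 (-1) 1 1 2 rfl
  have h30 := S10_rel_r₂ 2 (-1) 1 1 3 rfl
  have h31 := S10_rel_r₂ 3 (-1) 0 1 4 rfl
  have h32 := S10_rel_s₂ 0 1 0 0 2 rfl
  have h33 := S10_rel_s₂ 2 0 1 0 3 rfl
  have h34 := S10_rel_s₂ 2 1 (-1) 0 1 rfl
  simp only [Int.reduceAdd, Int.reduceSub, Int.reduceNeg] at *
  linear_combination 1 * h1 + (-qVar) * h2 + 1 * h3 + (-1) * h4 + (-qVar ^ 3 + zVar * qVar ^ 4) * h5 + (-1) *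
    h6 + (-qVar) * h7 + qVar * h8 + (-qVar) * h9 + qVar * h10 + (-1 + zVar * qVar) * h11 +
    (-1) * h12 + 1 * h13 + (qVar - zVar * qVar ^ 2) * h14 + (zVar * qVar ^ 2 - zVar ^ 2 * qVar
    ^ 3) * h15 + (-zVar * qVar ^ 3 + zVar ^ 2 * qVar ^ 4) * h16 + (-zVar * qVar ^ 2 + zVar ^ 2
    * qVar ^ 3) * h17 + qVar * h18 + zVar * h19 + (-qVar + zVar * qVar ^ 2) * h20 + 1 * h21 +
    zVar * qVar * h22 + (-zVar * qVar) * h23 + (-zVar * qVar ^ 2) * h24 + (zVar * qVar ^ 3 -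
    zVar ^ 2 * qVar ^ 4) * h25 + (zVar ^ 2 * qVar ^ 5 - zVar ^ 3 * qVar ^ 6) * h26 + 1 * h27 +
    1 * h28 + (-1) * h29 + (-1 + zVar * qVar) * h30 + (zVar * qVar ^ 2 - zVar ^ 2 * qVar ^ 3)
    * h31 + (-1) * h32 + (1 - zVar * qVar) * h33 + zVar * qVar * h34

theorem sumSide_403_eq :
    sumSide 11 = zShift 1 (sumSide 10) + zShift 1 (sumSide 7)
       - (1 - zVar * qVar) * zShift 2 (sumSide 8) := by
  simp only [sumSide_502, sumSide_412, sumSide_331, sumSide_403, map_sub, map_add, map_mul, map_pow,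
    map_one, zShift_S10, zShift_qVar, zShift_zVar, Nat.cast_one, Nat.cast_ofNat, Int.reduceAdd,
    Int.reduceNeg]
  ring

theorem sumSide_system : CorteelWelshSystem sumSide :=
  ⟨sumSide_700_eq,
    sumSide_610_eq,
    sumSide_520_eq,
    sumSide_511_eq,
    sumSide_421_eq,
    sumSide_322_eq,
    sumSide_601_eq,
    sumSide_502_eq,
    sumSide_412_eq,
    sumSide_430_eq,
    sumSide_331_eq,
    sumSide_403_eq⟩

/-! ### Maximum, weight and finiteness for cylindric partitions. -/

namespace CylindricPartition

variable {r : ℕ} {c : Fin (r + 1) → ℕ}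

theorem ext_part {Λ M : CylindricPartition c} (h : ∀ i j, Λ.part i j = M.part i j) : Λ = M := by
  cases Λ; cases M
  congr
  funext i j
  exact h i j

theorem part_zero_le_max (Λ : CylindricPartition c) (i : Fin (r + 1)) : Λ.part i 0 ≤ Λ.max :=
  Finset.le_sup (f := fun i => Λ.part i 0) (Finset.mem_univ i)

theorem part_le_max (Λ : CylindricPartition c) (i : Fin (r + 1)) (j : ℕ) : Λ.part i j ≤ Λ.max :=
  (Λ.antitone i (Nat.zero_le j)).trans (Λ.part_zero_le_max i)

theorem max_le_iff (Λ : CylindricPartition c) (n : ℕ) : Λ.max ≤ n ↔ ∀ i, Λ.part i 0 ≤ n := by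
  simp [CylindricPartition.max, Finset.sup_le_iff]

theorem exists_part_zero_eq_max (Λ : CylindricPartition c) : ∃ i, Λ.part i 0 = Λ.max := by
  obtain ⟨i, -, hi⟩ := Finset.exists_mem_eq_sup Finset.univ Finset.univ_nonempty
    (fun i => Λ.part i 0)
  exact ⟨i, hi.symm⟩

/-- The parts with indices $0,\dots,j$ are all at least the one with index $j$. This bounds both the
size and the number of nonzero parts by the weight, whence the finiteness below. -/
theorem succ_mul_part_le_weight (Λ : CylindricPartition c) (i : Fin (r + 1)) (j : ℕ) :
    (j + 1) * Λ.part i j ≤ Λ.weight := by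
  have h1 : (∑ᶠ k, Λ.part i k) ≤ Λ.weight :=
    Finset.single_le_sum (f := fun i => ∑ᶠ k, Λ.part i k) (fun _ _ => Nat.zero_le _)
      (Finset.mem_univ i)
  refine le_trans ?_ h1
  rw [finsum_eq_sum_of_support_subset (s := (Λ.finite_support i).toFinset ∪ Finset.range (j + 1))
    _ (fun k hk => by simpa using Or.inl hk)]
  calc (j + 1) * Λ.part i j = ∑ _k ∈ Finset.range (j + 1), Λ.part i j := by simp
    _ ≤ ∑ k ∈ Finset.range (j + 1), Λ.part i k :=
      Finset.sum_le_sum fun k hk => Λ.antitone i (by simpa [Nat.lt_succ_iff] using hk)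
    _ ≤ _ := Finset.sum_le_sum_of_subset Finset.subset_union_right

instance finite_weight_eq (N : ℕ) : Finite {Λ : CylindricPartition c // Λ.weight = N} := by
  have hb : ∀ (Λ : {Λ : CylindricPartition c // Λ.weight = N}) i j,
      (j + 1) * Λ.1.part i j ≤ N := fun Λ i j =>
    (Λ.1.succ_mul_part_le_weight i j).trans Λ.2.le
  have hle : ∀ (Λ : {Λ : CylindricPartition c // Λ.weight = N}) i j, Λ.1.part i j < N + 1 :=
    fun Λ i j => Nat.lt_succ_of_le ((Nat.le_mul_of_pos_left _ j.succ_pos).trans (hb Λ i j))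
  have hz : ∀ (Λ : {Λ : CylindricPartition c // Λ.weight = N}) i j, N ≤ j → Λ.1.part i j = 0 := by
    intro Λ i j hj
    by_contra h0
    have := Nat.le_mul_of_pos_right (j + 1) (Nat.pos_of_ne_zero h0)
    have := hb Λ i j
    omega
  refine Finite.of_injective
    (β := Fin (r + 1) → Fin N → Fin (N + 1)) (fun Λ i j => ⟨Λ.1.part i j, hle Λ i j⟩) ?_
  intro Λ M h
  refine Subtype.ext (ext_part fun i j => ?_)
  by_cases hj : j < N
  · simpa using congrArg Fin.val (congrFun (congrFun h i) ⟨j, hj⟩)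
  · rw [hz Λ i j (by omega), hz M i j (by omega)]

theorem finite_setOf (p : CylindricPartition c → Prop) (N : ℕ) :
    {Λ : CylindricPartition c | p Λ ∧ Λ.weight = N}.Finite :=
  Set.Finite.subset (s := {Λ : CylindricPartition c | Λ.weight = N}) (finite_weight_eq N)
    fun _ h => h.2

/-- If some part of the profile is positive, then the maximum is attained at an index where the
profile is positive. -/
theorem exists_ne_zero_part_zero_eq_max (hc : ∃ i, c i ≠ 0) (Λ : CylindricPartition c) :
    ∃ i, c i ≠ 0 ∧ Λ.part i 0 = Λ.max := by
  by_contra! hcon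
  -- When $c_{i+1}=0$ the first part of component $i$ dominates that of component $i+1$, so the
  -- maximum travels backwards around the cycle until it meets a positive entry.
  have step : ∀ i, Λ.part (i + 1) 0 = Λ.max → Λ.part i 0 = Λ.max := by
    intro i hi
    have h0 : c (i + 1) = 0 := by
      by_contra h
      exact hcon _ h hi
    have h1 := Λ.cylindric i 0
    rw [h0, add_zero, hi] at h1
    exact le_antisymm (Λ.part_zero_le_max i) h1
  obtain ⟨i, hi⟩ := Λ.exists_part_zero_eq_max
  have hall : ∀ k : Fin (r + 1), Λ.part (i - k) 0 = Λ.max := by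
    intro k
    induction k using Fin.induction with
    | zero => simpa using hi
    | succ k ih =>
      refine step _ ?_
      rw [← ih, ← Fin.coeSucc_eq_succ, sub_add_eq_sub_sub, sub_add_cancel]
  obtain ⟨k, hk⟩ := hc
  refine hcon k hk ?_
  have := hall (i - k)
  rwa [sub_sub_cancel] at this

end CylindricPartition

/-! ### Removal of first parts and inclusion–exclusion. -/

/-- The profile `c(J)` of the cylindric partition obtained by removing the first parts of the
components with index in `J`. -/
def cwProfile {r : ℕ} (c : Fin (r + 1) → ℕ) (J : Finset (Fin (r + 1))) : Fin (r + 1) → ℕ := fun i =>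
  if i ∈ J then (if i - 1 ∈ J then c i else c i - 1) else (if i - 1 ∈ J then c i + 1 else c i)

namespace CylindricPartition

variable {r : ℕ} {c : Fin (r + 1) → ℕ}

/-- Remove the first parts of the components with index in `J`. -/
def removeFirst (J : Finset (Fin (r + 1))) (hJ : ∀ i ∈ J, c i ≠ 0) (Λ : CylindricPartition c) :
    CylindricPartition (cwProfile c J) where
  part i j := if i ∈ J then Λ.part i (j + 1) else Λ.part i j
  antitone i := by
    intro a b h
    dsimp only
    split_ifs
    · exact Λ.antitone i (by omega)
    · exact Λ.antitone i h
  finite_support i := by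
    by_cases hi : i ∈ J
    · simp only [hi, if_true]
      exact (Λ.finite_support i).preimage (f := fun j => j + 1) (fun a _ b _ h => by simpa using h)
    · simpa [hi] using Λ.finite_support i
  cylindric i j := by
    have h0 := Λ.cylindric i j
    have h1 := Λ.cylindric i (j + 1)
    simp only [cwProfile, add_sub_cancel_right]
    by_cases ha : i + 1 ∈ J <;> by_cases hb : i ∈ J <;> simp only [ha, hb, if_true, if_false]
    · rwa [show j + c (i + 1) + 1 = j + 1 + c (i + 1) by omega]
    · rwa [show j + (c (i + 1) - 1) + 1 = j + c (i + 1) by have := hJ _ ha; omega]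
    · rwa [show j + (c (i + 1) + 1) = j + 1 + c (i + 1) by omega]
    · exact h0

/-- Insert a new first part `n` in the components with index in `J`. -/
def insertFirst (J : Finset (Fin (r + 1))) (hJ : ∀ i ∈ J, c i ≠ 0) (n : ℕ)
    (M : CylindricPartition (cwProfile c J)) (hM : M.max ≤ n) : CylindricPartition c where
  part i j := if i ∈ J then (if j = 0 then n else M.part i (j - 1)) else M.part i j
  antitone i := by
    intro a b h
    dsimp only
    split_ifs with h1 h2 h3 h4
    · exact le_rfl
    · omega
    · exact (M.part_le_max _ _).trans hM
    · exact M.antitone i (by omega)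
    · exact M.antitone i h
  finite_support i := by
    refine (((M.finite_support i).image (fun j => j + 1)).union
      ((M.finite_support i).union (Set.finite_singleton 0))).subset ?_
    intro j hj
    simp only [Function.mem_support] at hj
    simp only [Set.mem_union, Set.mem_image, Function.mem_support, Set.mem_singleton_iff]
    split_ifs at hj with h1 h2
    · exact Or.inr (Or.inr h2)
    · exact Or.inl ⟨j - 1, hj, by omega⟩
    · exact Or.inr (Or.inl hj)
  cylindric i j := by
    have h0 := M.cylindric i j
    have h1 := M.cylindric i (j - 1)
    have hm := fun i j => (M.part_le_max i j).trans hM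
    simp only [cwProfile, add_sub_cancel_right] at h0 h1
    by_cases ha : i + 1 ∈ J <;> by_cases hb : i ∈ J <;>
      simp only [ha, hb, if_true, if_false] at h0 h1 ⊢
    -- Since $c_{i+1}>0$, the index $j+c_{i+1}$ is positive: the inserted part $n$ of component
    -- $i+1$ is never on the smaller side of an inequality.
    · have := hJ _ ha
      rw [if_neg (by omega)]
      split_ifs with hj
      · exact hm _ _
      · rwa [show j + c (i + 1) - 1 = j - 1 + c (i + 1) by omega]
    · have := hJ _ ha
      rw [if_neg (by omega)]
      rwa [show j + c (i + 1) - 1 = j + (c (i + 1) - 1) by omega]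
    · split_ifs with hj
      · exact hm _ _
      · rwa [show j + c (i + 1) = j - 1 + (c (i + 1) + 1) by omega]
    · exact h0

theorem finsum_part_succ {f : ℕ → ℕ} (hf : (Function.support f).Finite) :
    ∑ᶠ j, f j = f 0 + ∑ᶠ j, f (j + 1) := by
  obtain ⟨m, hm⟩ := hf.bddAbove
  have h : ∀ j, m < j → f j = 0 := fun j hj => by
    by_contra h0
    exact absurd (hm h0) (by omega)
  rw [finsum_eq_sum_of_support_subset (s := Finset.range (m + 2)) f fun j hj => by
      have := hm hj
      simp; omega,
    finsum_eq_sum_of_support_subset (s := Finset.range (m + 1)) _ fun j hj => by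
      have := hm hj
      simp at this ⊢; omega,
    Finset.sum_range_succ', add_comm]

theorem weight_eq_add_removeFirst (J : Finset (Fin (r + 1))) (hJ : ∀ i ∈ J, c i ≠ 0) (n : ℕ)
    (Λ : CylindricPartition c) (hn : ∀ i ∈ J, Λ.part i 0 = n) :
    Λ.weight = J.card * n + (Λ.removeFirst J hJ).weight := by
  have h : ∀ i, ∑ᶠ j, Λ.part i j = (if i ∈ J then n else 0) +
      ∑ᶠ j, (Λ.removeFirst J hJ).part i j := by
    intro i
    by_cases hi : i ∈ J
    · simp only [removeFirst, hi, if_true]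
      rw [finsum_part_succ (Λ.finite_support i), hn i hi]
    · simp [removeFirst, hi]
  simp only [weight, h, Finset.sum_add_distrib]
  simp

/-- Removing first parts equal to `n` is a bijection. -/
def removeFirstEquiv (J : Finset (Fin (r + 1))) (hJ : ∀ i ∈ J, c i ≠ 0) (n N : ℕ) :
    {Λ : CylindricPartition c //
      (Λ.max ≤ n ∧ ∀ i ∈ J, Λ.part i 0 = n) ∧ Λ.weight = J.card * n + N} ≃
    {M : CylindricPartition (cwProfile c J) // M.max ≤ n ∧ M.weight = N} where
  toFun Λ := ⟨Λ.1.removeFirst J hJ, by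
    rw [max_le_iff]
    intro i
    simp only [removeFirst]
    split_ifs <;> exact (Λ.1.part_le_max _ _).trans Λ.2.1.1, by
    have := weight_eq_add_removeFirst J hJ n Λ.1 Λ.2.1.2
    have := Λ.2.2
    omega⟩
  invFun M := ⟨M.1.insertFirst J hJ n M.2.1, by
    have hn : ∀ i ∈ J, (M.1.insertFirst J hJ n M.2.1).part i 0 = n := fun i hi => by
      simp [insertFirst, hi]
    refine ⟨⟨?_, hn⟩, ?_⟩
    · rw [max_le_iff]
      intro i
      simp only [insertFirst, if_true]
      split_ifs
      · exact le_rfl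
      · exact (M.1.part_le_max _ _).trans M.2.1
    · rw [weight_eq_add_removeFirst J hJ n _ hn]
      congr 1
      refine Eq.trans (congrArg weight ?_) M.2.2
      refine ext_part fun i j => ?_
      simp only [removeFirst, insertFirst]
      split_ifs <;> simp_all⟩
  left_inv Λ := by
    refine Subtype.ext (ext_part fun i j => ?_)
    simp only [removeFirst, insertFirst]
    split_ifs with h1 h2
    · rw [h2, Λ.2.1.2 i h1]
    · rw [Nat.sub_add_cancel (by omega)]
    · rfl
  right_inv M := by
    refine Subtype.ext (ext_part fun i j => ?_)
    simp only [removeFirst, insertFirst]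
    split_ifs <;> simp_all

/-- Maximum $n$ means that all parts are at most $n$ and that some component with $c_i\ne0$ starts
with $n$. Restricting to these components is what allows the first parts to be removed afterwards.
-/
theorem card_max_eq (hc : ∃ i, c i ≠ 0) (n N : ℕ) :
    (Nat.card {Λ : CylindricPartition c // Λ.max = n ∧ Λ.weight = N} : ℤ) =
      ∑ J ∈ (Finset.univ.filter fun i => c i ≠ 0).powerset.filter (·.Nonempty),
        (-1) ^ (J.card + 1) * (Nat.card {Λ : CylindricPartition c //
          (Λ.max ≤ n ∧ ∀ i ∈ J, Λ.part i 0 = n) ∧ Λ.weight = N} : ℤ) := by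
  classical
  have hcard : ∀ p : CylindricPartition c → Prop,
      Nat.card {Λ : CylindricPartition c // p Λ ∧ Λ.weight = N} =
        (finite_setOf p N).toFinset.card := fun p => by
    rw [← Nat.card_eq_card_finite_toFinset]; rfl
  have h := Finset.inclusion_exclusion_card_biUnion (Finset.univ.filter fun i => c i ≠ 0)
    (fun i => (finite_setOf (fun Λ : CylindricPartition c => Λ.max ≤ n ∧ Λ.part i 0 = n) N).toFinset)
  rw [hcard]
  convert h using 1
  · congr 2
    ext Λ
    simp only [Set.Finite.mem_toFinset, Set.mem_ofPred_eq, Finset.mem_biUnion, Finset.mem_filter,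
      Finset.mem_univ, true_and]
    constructor
    · rintro ⟨rfl, hw⟩
      obtain ⟨i, hi, hm⟩ := Λ.exists_ne_zero_part_zero_eq_max hc
      exact ⟨i, hi, ⟨le_rfl, hm⟩, hw⟩
    · rintro ⟨i, hi, ⟨hm, hp⟩, hw⟩
      exact ⟨le_antisymm hm (hp ▸ Λ.part_zero_le_max i), hw⟩
  · rw [← Finset.sum_coe_sort]
    refine Finset.sum_congr rfl fun J _ => ?_
    congr 2
    rw [hcard]
    congr 1
    ext Λ
    have hne := (Finset.mem_filter.1 J.2).2
    simp only [Set.Finite.mem_toFinset, Set.mem_ofPred_eq, Finset.mem_inf']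
    constructor
    · rintro ⟨⟨hm, hp⟩, hw⟩ i hi
      exact ⟨⟨hm, hp i hi⟩, hw⟩
    · intro hall
      obtain ⟨i, hi⟩ := hne
      exact ⟨⟨(hall i hi).1.1, fun k hk => (hall k hk).1.2⟩, (hall i hi).2⟩

end CylindricPartition

/-! ### The functional equation for generating functions. -/

/-- The generating function of cylindric partitions whose parts are bounded by the exponent of
`z`. -/
noncomputable def boundedF {r : ℕ} (c : Fin (r + 1) → ℕ) : PowerSeries (PowerSeries ℚ) :=
  PowerSeries.mk fun n => PowerSeries.mk fun N =>
    (Nat.card {Λ : CylindricPartition c // Λ.max ≤ n ∧ Λ.weight = N} : ℚ)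

/-- Telescoping in the bound: maximum equal to $n+1$ is maximum at most $n+1$ without maximum at
most $n$. -/
theorem F_eq_one_sub_X_mul_boundedF {r : ℕ} (c : Fin (r + 1) → ℕ) :
    F c = (1 - X) * boundedF c := by
  ext n N
  rw [sub_mul, one_mul, map_sub, map_sub]
  rcases n with _ | n
  · rw [coeff_zero_X_mul, map_zero, sub_zero]
    simp [F, boundedF]
  · rw [coeff_succ_X_mul]
    simp only [F, boundedF, coeff_mk]
    rw [eq_sub_iff_add_eq]
    norm_cast
    have hf : ∀ p : CylindricPartition c → Prop, Finite {Λ // p Λ ∧ Λ.weight = N} := fun p =>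
      CylindricPartition.finite_setOf p N
    have := hf (fun Λ => Λ.max = n + 1)
    have := hf (fun Λ => Λ.max ≤ n)
    have hd : Disjoint (fun Λ : CylindricPartition c => Λ.max = n + 1 ∧ Λ.weight = N)
        (fun Λ => Λ.max ≤ n ∧ Λ.weight = N) := by
      rw [Pi.disjoint_iff]
      intro Λ
      rw [Prop.disjoint_iff]
      omega
    rw [← Nat.card_sum]
    classical
    refine Nat.card_congr ((subtypeOrEquiv _ _ hd).symm.trans (Equiv.subtypeEquivRight fun Λ => ?_))
    omega

/-- The Corteel–Welsh functional equation. -/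
theorem F_eq_sum_boundedF {r : ℕ} {c : Fin (r + 1) → ℕ} (hc : ∃ i, c i ≠ 0) :
    F c = ∑ J ∈ (Finset.univ.filter fun i => c i ≠ 0).powerset.filter (·.Nonempty),
      (-1) ^ (J.card + 1) * rescale (X ^ J.card) (boundedF (cwProfile c J)) := by
  ext n N
  have h := congrArg (Int.cast : ℤ → ℚ) (CylindricPartition.card_max_eq hc n N)
  simp only [F, coeff_mk, map_sum]
  push_cast at h
  rw [h]
  refine Finset.sum_congr rfl fun J hJ => ?_
  have hJ' : ∀ i ∈ J, c i ≠ 0 := fun i hi => by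
    have := (Finset.mem_powerset.1 (Finset.mem_filter.1 hJ).1) hi
    simpa using this
  have hs : ((-1) ^ (J.card + 1) : PowerSeries (PowerSeries ℚ)) =
      C (C ((-1) ^ (J.card + 1))) := by simp
  rw [hs, coeff_C_mul, coeff_C_mul, coeff_rescale, ← pow_mul, coeff_X_pow_mul']
  congr 1
  split_ifs with hN
  · obtain ⟨m, rfl⟩ := Nat.exists_eq_add_of_le hN
    rw [Nat.add_sub_cancel_left]
    simp only [boundedF, coeff_mk]
    rw [Nat.card_congr (CylindricPartition.removeFirstEquiv J hJ' n m)]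
  -- If $N<n|J|$, the parts equal to $n$ already exceed the weight.
  · rw [Nat.cast_eq_zero, Nat.card_eq_zero]
    left
    constructor
    rintro ⟨Λ, ⟨_, hp⟩, hw⟩
    have := Λ.weight_eq_add_removeFirst J hJ' n hp
    omega

/-! ### Infinite Pochhammer symbols -/

/-- The finite products satisfy this with one factor more on the left, and each coefficient is
already reached by a long enough finite product. -/
theorem qPochInf_eq_mul (a : PowerSeries (PowerSeries ℚ)) :
    qPochInf a = (1 - a) * qPochInf (a * C X) := by
  have h : ∀ M, qPoch a (C X) (M + 1) = (1 - a) * qPoch (a * C X) (C X) M := fun M => by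
    rw [qPoch, Finset.prod_range_succ', qPoch, mul_comm, pow_zero, mul_one]
    congr 1
    exact Finset.prod_congr rfl fun t _ => by ring
  ext n N
  rw [← coeff_qPoch_eq a n N (N + 2) (by omega), h]
  simp only [coeff_mul, map_sum]
  refine Finset.sum_congr rfl fun x _ => Finset.sum_congr rfl fun y hy => ?_
  rw [coeff_qPoch_eq _ _ _ _ (by
    have := Finset.HasAntidiagonal.mem_antidiagonal.1 hy
    omega)]

theorem rescale_X_pow_qPochInf (k : ℕ) (a : PowerSeries (PowerSeries ℚ)) :
    rescale (X ^ k) (qPochInf a) = qPochInf (rescale (X ^ k) a) := by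
  have h : ∀ M, rescale (X ^ k) (qPoch a (C X) M) = qPoch (rescale (X ^ k) a) (C X) M := fun M => by
    have hC : rescale (X ^ k : PowerSeries ℚ) (C X) = C X := by
      ext1 n
      rw [coeff_rescale, coeff_C]
      split_ifs with h <;> simp [h]
    simp only [qPoch, map_prod, map_sub, map_one, map_mul, map_pow, hC]
  ext n N
  rw [← coeff_qPoch_eq _ n N (N + 1) le_rfl, ← h, coeff_rescale, coeff_rescale, ← pow_mul,
    coeff_X_pow_mul', coeff_X_pow_mul']
  split_ifs with hN
  · rw [coeff_qPoch_eq _ _ _ _ (by omega)]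
  · rfl

theorem toLaurent_rescale (k : ℕ) (f : PowerSeries (PowerSeries ℚ)) :
    toLaurent (rescale (X ^ k) f) = zShift k (toLaurent f) := by
  rw [toLaurent, zShift, ← ofPowerSeries_X_pow]
  exact (rescale_map _ _ _).symm

theorem toLaurent_X : toLaurent X = zVar := by simp [toLaurent, zVar]

theorem toLaurent_C_X : toLaurent (C X) = qVar := by
  simp [toLaurent, qVar, HahnSeries.ofPowerSeries_X]

/-- `(q; q)_∞` as a power series in `q`. -/
noncomputable def eulerProd : PowerSeries ℚ := coeff 0 (qPochInf (C X))

theorem constantCoeff_eulerProd : constantCoeff eulerProd = 1 := by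
  rw [← coeff_zero_eq_constantCoeff_apply, eulerProd, ← coeff_qPoch_eq _ 0 0 1 (by omega)]
  simp [qPoch]

theorem eulerProd_ne_zero : eulerProd ≠ 0 := fun h => by
  have := constantCoeff_eulerProd
  simp [h] at this

theorem constantCoeff_toLaurent_qPochInf_C_X :
    constantCoeff (toLaurent (qPochInf (C X))) = HahnSeries.ofPowerSeries ℤ ℚ eulerProd := by
  rw [← coeff_zero_eq_constantCoeff_apply, toLaurent, coeff_map, eulerProd]

theorem constantCoeff_toLaurent_qPochInf_C_X_ne_zero :
    constantCoeff (toLaurent (qPochInf (C X))) ≠ 0 := by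
  rw [constantCoeff_toLaurent_qPochInf_C_X, Ne, map_eq_zero_iff _ HahnSeries.ofPowerSeries_injective]
  exact eulerProd_ne_zero

theorem zShift_inv_toLaurent_qPochInf (k : ℕ) :
    zShift k (toLaurent (qPochInf (C X)))⁻¹ = (toLaurent (qPochInf (C X)))⁻¹ := by
  have h0 := PowerSeries.mul_inv_cancel _ constantCoeff_toLaurent_qPochInf_C_X_ne_zero
  have hC : rescale (X ^ k : PowerSeries ℚ) (C X) = C X := by
    ext1 n
    rw [coeff_rescale, coeff_C]
    split_ifs with h <;> simp [h]
  have h1 := congrArg (zShift k) h0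
  rw [map_mul, map_one, ← toLaurent_rescale, rescale_X_pow_qPochInf, hC] at h1
  linear_combination (toLaurent (qPochInf (C X)))⁻¹ * h1 -
    zShift k (toLaurent (qPochInf (C X)))⁻¹ * h0

/-- `(z q^k; q)_∞`. -/
noncomputable def zPochInf (k : ℕ) : PowerSeries (PowerSeries ℚ) := qPochInf (X * C (X ^ k))

theorem zPochInf_eq_mul (k : ℕ) : zPochInf k = (1 - X * C (X ^ k)) * zPochInf (k + 1) := by
  rw [zPochInf, qPochInf_eq_mul, zPochInf, mul_assoc X, ← map_mul, pow_succ]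

theorem rescale_zPochInf_zero (k : ℕ) : rescale (X ^ k) (zPochInf 0) = zPochInf k := by
  rw [zPochInf, rescale_X_pow_qPochInf, zPochInf]
  simp [rescale_X, mul_comm]

theorem zPochInf_one_eq (m : ℕ) : zPochInf 1 = qPoch (X * C X) (C X) m * zPochInf (m + 1) := by
  induction m with
  | zero => simp [qPoch]
  | succ m ih =>
    rw [ih, zPochInf_eq_mul (m + 1), qPoch, qPoch, Finset.prod_range_succ, pow_succ', map_mul,
      map_pow]
    ring

/-- The factor $1-z$ of $F_c$ completes $(zq)_\infty$ to $(z)_\infty$. -/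
theorem H_eq_boundedF {r : ℕ} (c : Fin (r + 1) → ℕ) :
    H c = toLaurent (zPochInf 0) * (toLaurent (qPochInf (C X)))⁻¹ * toLaurent (boundedF c) := by
  have h : qPochInf (X * C X) = zPochInf 1 := by rw [zPochInf, pow_one]
  have h0 := zPochInf_eq_mul 0
  rw [pow_zero, map_one, mul_one, zero_add] at h0
  rw [H, F_eq_one_sub_X_mul_boundedF, h, h0]
  simp only [map_mul]
  ring

/-- The shift turns $(z)_\infty$ into $(zq^{|J|})_\infty$, and
$(zq)_\infty=(zq;q)_{|J|-1}(zq^{|J|})_\infty$; the finite product is the coefficient. -/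
theorem H_eq_sum {r : ℕ} {c : Fin (r + 1) → ℕ} (hc : ∃ i, c i ≠ 0) :
    H c = ∑ J ∈ (Finset.univ.filter fun i => c i ≠ 0).powerset.filter (·.Nonempty),
      (-1) ^ (J.card + 1) * qPoch (zVar * qVar) qVar (J.card - 1) *
        zShift J.card (H (cwProfile c J)) := by
  rw [H, F_eq_sum_boundedF hc, map_sum, Finset.mul_sum]
  refine Finset.sum_congr rfl fun J hJ => ?_
  have hk : J.card - 1 + 1 = J.card :=
    Nat.sub_add_cancel (Finset.card_pos.2 (Finset.mem_filter.1 hJ).2)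
  have h : qPochInf (X * C X) = zPochInf 1 := by rw [zPochInf, pow_one]
  have hq : toLaurent (qPoch (X * C X) (C X) (J.card - 1)) =
      qPoch (zVar * qVar) qVar (J.card - 1) := by
    simp only [qPoch, map_prod, map_sub, map_one, map_mul, map_pow, toLaurent_X, toLaurent_C_X]
  rw [H_eq_boundedF, map_mul, map_mul (zShift _), map_mul (zShift _), zShift_inv_toLaurent_qPochInf, h,
    zPochInf_one_eq (J.card - 1), hk, map_mul, hq, ← toLaurent_rescale,
    ← toLaurent_rescale, rescale_zPochInf_zero]
  simp only [map_pow, map_neg, map_one]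
  ring

/-! ### Rotation -/

/-- Rotating the components of a cylindric partition. -/
def rotEquiv (i : Fin 3) (c : Fin 3 → ℕ) :
    CylindricPartition (r := 2) c ≃ CylindricPartition (r := 2) (rot i c) where
  toFun Λ :=
    { part := fun j => Λ.part (j + i)
      antitone := fun j => Λ.antitone _
      finite_support := fun j => Λ.finite_support _
      cylindric := fun j k => by
        have := Λ.cylindric (j + i) k
        rwa [add_right_comm] at this }
  invFun M :=
    { part := fun j => M.part (j - i)
      antitone := fun j => M.antitone _
      finite_support := fun j => M.finite_support _
      cylindric := fun j k => by
        have := M.cylindric (j - i) k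
        rwa [rot, add_right_comm, sub_add_cancel, sub_add_eq_add_sub] at this }
  left_inv Λ := CylindricPartition.ext_part fun j k => by simp
  right_inv M := CylindricPartition.ext_part fun j k => by simp

theorem rotEquiv_part (i : Fin 3) (c : Fin 3 → ℕ) (Λ : CylindricPartition (r := 2) c) (j : Fin 3) :
    (rotEquiv i c Λ).part j = Λ.part (j + i) := rfl

theorem F_rot (i : Fin 3) (c : Fin 3 → ℕ) : F (r := 2) (rot i c) = F (r := 2) c := by
  ext n N
  simp only [F, coeff_mk]
  congr 1
  refine (Nat.card_congr ((rotEquiv i c).subtypeEquiv fun Λ => ?_)).symm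
  have hm : (rotEquiv i c Λ).max = Λ.max := by
    refine eq_of_forall_ge_iff fun n => ?_
    simp only [CylindricPartition.max_le_iff, rotEquiv_part]
    exact ⟨fun h j => by simpa using h (j - i), fun h j => h (j + i)⟩
  have hw : (rotEquiv i c Λ).weight = Λ.weight :=
    Fintype.sum_equiv (Equiv.addRight i) _ _ fun j => rfl
  rw [hm, hw]

theorem H_rot (i : Fin 3) (c : Fin 3 → ℕ) : H (r := 2) (rot i c) = H (r := 2) c := by
  rw [H, H, F_rot]

theorem H_rotate (a b c : ℕ) : H ![a, b, c] = H ![b, c, a] := by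
  rw [← H_rot 1 ![a, b, c]]
  congr 1
  funext j
  fin_cases j <;> rfl

/-! ### Constant terms -/

theorem coeff_zero_F {r : ℕ} (c : Fin (r + 1) → ℕ) : coeff 0 (F c) = 1 := by
  let Z : CylindricPartition c :=
    ⟨fun _ _ => 0, fun _ _ _ _ => le_rfl, fun _ => by simp, fun _ _ => le_rfl⟩
  have hZ : ∀ Λ : CylindricPartition c, Λ.max = 0 → Λ = Z := fun Λ h =>
    CylindricPartition.ext_part fun i j => Nat.le_zero.1 (h ▸ Λ.part_le_max i j)
  have hZm : Z.max = 0 := by simp [CylindricPartition.max, Z]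
  have hZw : Z.weight = 0 := by simp [CylindricPartition.weight, Z]
  ext N
  simp only [F, coeff_mk, coeff_one]
  split_ifs with hN
  · subst hN
    rw [Nat.cast_eq_one, Nat.card_eq_one_iff_unique]
    exact ⟨⟨fun a b => Subtype.ext ((hZ _ a.2.1).trans (hZ _ b.2.1).symm)⟩, ⟨⟨Z, hZm, hZw⟩⟩⟩
  · rw [Nat.cast_eq_zero, Nat.card_eq_zero]
    left
    constructor
    rintro ⟨Λ, hm, hw⟩
    rw [hZ Λ hm, hZw] at hw
    exact hN hw.symm

theorem coeff_zero_H_mul {r : ℕ} (c : Fin (r + 1) → ℕ) :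
    coeff 0 (H c) * HahnSeries.ofPowerSeries ℤ ℚ eulerProd = 1 := by
  have h1 : coeff 0 (qPochInf (X * C X)) = 1 := by
    ext N
    rw [← coeff_qPoch_eq _ 0 N (N + 1) le_rfl, coeff_zero_eq_constantCoeff_apply, qPoch, map_prod]
    simp
  have h2 := coeff_zero_F c
  rw [coeff_zero_eq_constantCoeff_apply] at h1 h2 ⊢
  have h3 : ∀ f, constantCoeff f = 1 → constantCoeff (toLaurent f) = 1 := fun f hf => by
    rw [← coeff_zero_eq_constantCoeff_apply, toLaurent, coeff_map, coeff_zero_eq_constantCoeff_apply,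
      hf, map_one]
  rw [H, map_mul, map_mul, h3 _ h1, h3 _ h2, constantCoeff_inv,
    constantCoeff_toLaurent_qPochInf_C_X, one_mul, mul_one]
  refine inv_mul_cancel₀ ?_
  rw [← constantCoeff_toLaurent_qPochInf_C_X]
  exact constantCoeff_toLaurent_qPochInf_C_X_ne_zero

/-! ### The system for the profiles of size 7. -/

theorem neg_one_fin_three : (-1 : Fin 3) = 2 := rfl

theorem H_of_one_ne_zero (a : ℕ) : H ![a + 1, 0, 0] = zShift 1 (H ![a, 1, 0]) := by
  have hI : (Finset.univ.filter fun i => (![a + 1, 0, 0] : Fin 3 → ℕ) i ≠ 0) = {0} := by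
    ext i; fin_cases i <;> simp
  have hP : ({0} : Finset (Fin 3)).powerset.filter (·.Nonempty) = {{0}} := by decide
  have h0 : cwProfile ![a + 1, 0, 0] {0} = ![a, 1, 0] := by
    funext i; fin_cases i <;> simp [cwProfile, neg_one_fin_three]
  rw [H_eq_sum ⟨0, by simp⟩, hI, hP, Finset.sum_singleton, h0]
  simp [qPoch]

theorem H_of_two_ne_zero (a b : ℕ) : H ![a + 1, b + 1, 0] =
    zShift 1 (H ![a, b + 2, 0]) + zShift 1 (H ![a + 1, b, 1])
      - (1 - zVar * qVar) * zShift 2 (H ![a, b + 1, 1]) := by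
  have hI : (Finset.univ.filter fun i => (![a + 1, b + 1, 0] : Fin 3 → ℕ) i ≠ 0) = {0, 1} := by
    ext i; fin_cases i <;> simp
  have hP : ({0, 1} : Finset (Fin 3)).powerset.filter (·.Nonempty) = {{0}, {1}, {0, 1}} := by
    decide
  have h0 : cwProfile ![a + 1, b + 1, 0] {0} = ![a, b + 2, 0] := by
    funext i; fin_cases i <;> simp [cwProfile, neg_one_fin_three]
  have h1 : cwProfile ![a + 1, b + 1, 0] {1} = ![a + 1, b, 1] := by
    funext i; fin_cases i <;> simp [cwProfile, neg_one_fin_three]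
  have h01 : cwProfile ![a + 1, b + 1, 0] {0, 1} = ![a, b + 1, 1] := by
    funext i; fin_cases i <;> simp [cwProfile, neg_one_fin_three]
  rw [H_eq_sum ⟨0, by simp⟩, hI, hP, Finset.sum_insert (by decide), Finset.sum_insert (by decide),
    Finset.sum_singleton, h0, h1, h01]
  simp [qPoch]
  ring

theorem H_of_three_ne_zero (a b c : ℕ) : H ![a + 1, b + 1, c + 1] =
    zShift 1 (H ![a, b + 2, c + 1]) + zShift 1 (H ![a + 1, b, c + 2])
        + zShift 1 (H ![a + 2, b + 1, c])
      - (1 - zVar * qVar) * (zShift 2 (H ![a, b + 1, c + 2]) + zShift 2 (H ![a + 1, b + 2, c])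
        + zShift 2 (H ![a + 2, b, c + 1]))
      + (1 - zVar * qVar) * (1 - zVar * qVar ^ 2) * zShift 3 (H ![a + 1, b + 1, c + 1]) := by
  have hI : (Finset.univ.filter fun i => (![a + 1, b + 1, c + 1] : Fin 3 → ℕ) i ≠ 0) =
      {0, 1, 2} := by
    ext i; fin_cases i <;> simp
  have hP : ({0, 1, 2} : Finset (Fin 3)).powerset.filter (·.Nonempty) =
      {{0}, {1}, {2}, {0, 1}, {0, 2}, {1, 2}, {0, 1, 2}} := by decide
  have h0 : cwProfile ![a + 1, b + 1, c + 1] {0} = ![a, b + 2, c + 1] := by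
    funext i; fin_cases i <;> simp [cwProfile, neg_one_fin_three]
  have h1 : cwProfile ![a + 1, b + 1, c + 1] {1} = ![a + 1, b, c + 2] := by
    funext i; fin_cases i <;> simp [cwProfile, neg_one_fin_three]
  have h2 : cwProfile ![a + 1, b + 1, c + 1] {2} = ![a + 2, b + 1, c] := by
    funext i; fin_cases i <;> simp [cwProfile, neg_one_fin_three]
  have h01 : cwProfile ![a + 1, b + 1, c + 1] {0, 1} = ![a, b + 1, c + 2] := by
    funext i; fin_cases i <;> simp [cwProfile, neg_one_fin_three]
  have h02 : cwProfile ![a + 1, b + 1, c + 1] {0, 2} = ![a + 1, b + 2, c] := by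
    funext i; fin_cases i <;> simp [cwProfile, neg_one_fin_three]
  have h12 : cwProfile ![a + 1, b + 1, c + 1] {1, 2} = ![a + 2, b, c + 1] := by
    funext i; fin_cases i <;> simp [cwProfile, neg_one_fin_three]
  have h012 : cwProfile ![a + 1, b + 1, c + 1] {0, 1, 2} = ![a + 1, b + 1, c + 1] := by
    funext i; fin_cases i <;> simp [cwProfile, neg_one_fin_three]
  have k0 : ({0} : Finset (Fin 3)).card = 1 := rfl
  have k1 : ({1} : Finset (Fin 3)).card = 1 := rfl
  have k2 : ({2} : Finset (Fin 3)).card = 1 := rfl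
  have k01 : ({0, 1} : Finset (Fin 3)).card = 2 := rfl
  have k02 : ({0, 2} : Finset (Fin 3)).card = 2 := rfl
  have k12 : ({1, 2} : Finset (Fin 3)).card = 2 := rfl
  have k012 : ({0, 1, 2} : Finset (Fin 3)).card = 3 := rfl
  have p0 : qPoch (zVar * qVar) qVar 0 = 1 := rfl
  have p1 : qPoch (zVar * qVar) qVar 1 = 1 - zVar * qVar := by simp [qPoch]
  have p2 : qPoch (zVar * qVar) qVar 2 = (1 - zVar * qVar) * (1 - zVar * qVar ^ 2) := by
    simp only [qPoch, Finset.prod_range_succ, Finset.prod_range_zero]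
    ring
  refine (H_eq_sum ⟨0, by simp⟩).trans ?_
  rw [hI, hP]
  iterate 6 rw [Finset.sum_insert (by decide)]
  rw [Finset.sum_singleton, h0, h1, h2, h01, h02, h12, h012, k0, k1, k2, k01, k02, k12, k012]
  simp only [Nat.reduceSub, p0, p1, p2]
  ring

/-- The twelve series `H_c`. -/
noncomputable def profileSide : Fin 12 → PowerSeries QLaurent :=
  ![H ![7, 0, 0],
    H ![6, 1, 0],
    H ![5, 2, 0],
    H ![5, 1, 1],
    H ![4, 2, 1],
    H ![3, 2, 2],
    H ![6, 0, 1],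
    H ![5, 0, 2],
    H ![4, 1, 2],
    H ![4, 3, 0],
    H ![3, 3, 1],
    H ![4, 0, 3]]

theorem profileSide_system : CorteelWelshSystem profileSide where
  eq_700 := by
    have h := H_of_one_ne_zero 6
    simp only [Nat.reduceAdd] at h
    change H ![7, 0, 0] = zShift 1 (H ![6, 1, 0])
    linear_combination h
  eq_610 := by
    have h := H_of_two_ne_zero 5 0
    simp only [Nat.reduceAdd] at h
    change H ![6, 1, 0] = zShift 1 (H ![5, 2, 0]) + zShift 1 (H ![6, 0, 1])
      - (1 - zVar * qVar) * zShift 2 (H ![5, 1, 1])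
    linear_combination h
  eq_520 := by
    have h := H_of_two_ne_zero 4 1
    simp only [Nat.reduceAdd] at h
    change H ![5, 2, 0] = zShift 1 (H ![4, 3, 0]) + zShift 1 (H ![5, 1, 1])
      - (1 - zVar * qVar) * zShift 2 (H ![4, 2, 1])
    linear_combination h
  eq_511 := by
    have h := H_of_three_ne_zero 4 0 0
    simp only [Nat.reduceAdd] at h
    change H ![5, 1, 1] = zShift 1 (H ![4, 2, 1]) + zShift 1 (H ![5, 0, 2]) + zShift 1 (H ![6, 1, 0])
      - (1 - zVar * qVar) * (zShift 2 (H ![4, 1, 2]) + zShift 2 (H ![5, 2, 0]) + zShift 2 (H ![6, 0, 1]))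
      + (1 - zVar * qVar) * (1 - zVar * qVar ^ 2) * zShift 3 (H ![5, 1, 1])
    linear_combination h
  eq_421 := by
    have h := H_of_three_ne_zero 3 1 0
    simp only [Nat.reduceAdd] at h
    change H ![4, 2, 1] = zShift 1 (H ![3, 3, 1]) + zShift 1 (H ![4, 1, 2]) + zShift 1 (H ![5, 2, 0])
      - (1 - zVar * qVar) * (zShift 2 (H ![3, 2, 2]) + zShift 2 (H ![4, 3, 0]) + zShift 2 (H ![5, 1, 1]))
      + (1 - zVar * qVar) * (1 - zVar * qVar ^ 2) * zShift 3 (H ![4, 2, 1])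
    linear_combination h
  eq_322 := by
    have h := H_of_three_ne_zero 2 1 1
    simp only [Nat.reduceAdd, H_rotate 2 3 2, H_rotate 3 1 3, H_rotate 1 3 3, H_rotate 2 2 3] at h
    change H ![3, 2, 2] = zShift 1 (H ![3, 2, 2]) + zShift 1 (H ![3, 3, 1]) + zShift 1 (H ![4, 2, 1])
      - (1 - zVar * qVar) * (zShift 2 (H ![3, 2, 2]) + zShift 2 (H ![3, 3, 1]) + zShift 2 (H ![4, 1, 2]))
      + (1 - zVar * qVar) * (1 - zVar * qVar ^ 2) * zShift 3 (H ![3, 2, 2])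
    linear_combination h
  eq_601 := by
    -- The two-entry equation wants the zero in last place, so it is taken at the rotation
    -- $(1,6,0)$; its other profiles are then rotated to the listed representatives.
    have h := H_of_two_ne_zero 0 5
    simp only [Nat.reduceAdd, H_rotate 1 6 0, H_rotate 0 7 0, H_rotate 1 5 1, H_rotate 0 6 1] at h
    change H ![6, 0, 1] = zShift 1 (H ![5, 1, 1]) + zShift 1 (H ![7, 0, 0])
      - (1 - zVar * qVar) * zShift 2 (H ![6, 1, 0])
    linear_combination h
  eq_502 := by
    have h := H_of_two_ne_zero 1 4
    simp only [Nat.reduceAdd, H_rotate 2 5 0, H_rotate 1 6 0, H_rotate 2 4 1, H_rotate 1 5 1] at h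
    change H ![5, 0, 2] = zShift 1 (H ![4, 1, 2]) + zShift 1 (H ![6, 0, 1])
      - (1 - zVar * qVar) * zShift 2 (H ![5, 1, 1])
    linear_combination h
  eq_412 := by
    have h := H_of_three_ne_zero 3 0 1
    simp only [Nat.reduceAdd, H_rotate 3 1 3, H_rotate 1 3 3] at h
    change H ![4, 1, 2] = zShift 1 (H ![3, 2, 2]) + zShift 1 (H ![4, 0, 3]) + zShift 1 (H ![5, 1, 1])
      - (1 - zVar * qVar) * (zShift 2 (H ![3, 3, 1]) + zShift 2 (H ![4, 2, 1]) + zShift 2 (H ![5, 0, 2]))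
      + (1 - zVar * qVar) * (1 - zVar * qVar ^ 2) * zShift 3 (H ![4, 1, 2])
    linear_combination h
  eq_430 := by
    have h := H_of_two_ne_zero 3 2
    simp only [Nat.reduceAdd, H_rotate 3 4 0] at h
    change H ![4, 3, 0] = zShift 1 (H ![4, 0, 3]) + zShift 1 (H ![4, 2, 1])
      - (1 - zVar * qVar) * zShift 2 (H ![3, 3, 1])
    linear_combination h
  eq_331 := by
    have h := H_of_three_ne_zero 2 2 0
    simp only [Nat.reduceAdd, H_rotate 2 4 1, H_rotate 2 3 2, H_rotate 3 4 0] at h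
    change H ![3, 3, 1] = zShift 1 (H ![4, 1, 2]) + zShift 1 (H ![3, 2, 2]) + zShift 1 (H ![4, 3, 0])
      - (1 - zVar * qVar) * (zShift 2 (H ![3, 2, 2]) + zShift 2 (H ![4, 0, 3]) + zShift 2 (H ![4, 2, 1]))
      + (1 - zVar * qVar) * (1 - zVar * qVar ^ 2) * zShift 3 (H ![3, 3, 1])
    linear_combination h
  eq_403 := by
    have h := H_of_two_ne_zero 2 3
    simp only [Nat.reduceAdd, H_rotate 3 4 0, H_rotate 2 5 0, H_rotate 2 4 1] at h
    change H ![4, 0, 3] = zShift 1 (H ![3, 3, 1]) + zShift 1 (H ![5, 0, 2])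
      - (1 - zVar * qVar) * zShift 2 (H ![4, 1, 2])
    linear_combination h

/-! ### Linearity, and constant terms of a solution. -/

theorem CorteelWelshSystem.sub {h g : Fin 12 → PowerSeries QLaurent} (hh : CorteelWelshSystem h)
    (hg : CorteelWelshSystem g) : CorteelWelshSystem (h - g) where
  eq_700 := by
    simp only [Pi.sub_apply, map_sub]
    linear_combination hh.eq_700 - hg.eq_700
  eq_610 := by
    simp only [Pi.sub_apply, map_sub]
    linear_combination hh.eq_610 - hg.eq_610
  eq_520 := by
    simp only [Pi.sub_apply, map_sub]
    linear_combination hh.eq_520 - hg.eq_520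
  eq_511 := by
    simp only [Pi.sub_apply, map_sub]
    linear_combination hh.eq_511 - hg.eq_511
  eq_421 := by
    simp only [Pi.sub_apply, map_sub]
    linear_combination hh.eq_421 - hg.eq_421
  eq_322 := by
    simp only [Pi.sub_apply, map_sub]
    linear_combination hh.eq_322 - hg.eq_322
  eq_601 := by
    simp only [Pi.sub_apply, map_sub]
    linear_combination hh.eq_601 - hg.eq_601
  eq_502 := by
    simp only [Pi.sub_apply, map_sub]
    linear_combination hh.eq_502 - hg.eq_502
  eq_412 := by
    simp only [Pi.sub_apply, map_sub]
    linear_combination hh.eq_412 - hg.eq_412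
  eq_430 := by
    simp only [Pi.sub_apply, map_sub]
    linear_combination hh.eq_430 - hg.eq_430
  eq_331 := by
    simp only [Pi.sub_apply, map_sub]
    linear_combination hh.eq_331 - hg.eq_331
  eq_403 := by
    simp only [Pi.sub_apply, map_sub]
    linear_combination hh.eq_403 - hg.eq_403

theorem coeff_zero_zShift (k : ℕ) (f : PowerSeries QLaurent) :
    coeff 0 (zShift k f) = coeff 0 f := by
  simp [zShift, coeff_rescale]

/-- At $z=0$ the shifts act trivially and the system becomes linear with integer coefficients. Its
solutions are the constant vectors, so one entry fixes all; the weights below solve it explicitly.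
-/
theorem CorteelWelshSystem.coeff_zero_eq_zero {d : Fin 12 → PowerSeries QLaurent}
    (hd : CorteelWelshSystem d) (h0 : coeff 0 (d 0) = 0) : ∀ i, coeff 0 (d i) = 0 := by
  have hz : coeff 0 zVar = (0 : QLaurent) := coeff_zero_X
  have hm : ∀ f g : PowerSeries QLaurent, coeff 0 (f * g) = coeff 0 f * coeff 0 g := fun f g => by
    simp only [coeff_zero_eq_constantCoeff_apply, map_mul]
  have e0 := congrArg (coeff 0) hd.eq_700
  have e1 := congrArg (coeff 0) hd.eq_610
  have e2 := congrArg (coeff 0) hd.eq_520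
  have e3 := congrArg (coeff 0) hd.eq_511
  have e4 := congrArg (coeff 0) hd.eq_421
  have e5 := congrArg (coeff 0) hd.eq_322
  have e6 := congrArg (coeff 0) hd.eq_601
  have e7 := congrArg (coeff 0) hd.eq_502
  have e8 := congrArg (coeff 0) hd.eq_412
  have e9 := congrArg (coeff 0) hd.eq_430
  have e10 := congrArg (coeff 0) hd.eq_331
  have e11 := congrArg (coeff 0) hd.eq_403
  simp only [map_add, map_sub, hm, hz, coeff_zero_zShift, coeff_zero_one, zero_mul, sub_zero,
    one_mul, mul_one] at e0 e1 e2 e3 e4 e5 e6 e7 e8 e9 e10 e11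
  have x1 : coeff 0 (d 1) = 0 := by linear_combination -e0 + h0
  have x2 : coeff 0 (d 2) = 0 := by linear_combination -2 * e0 - e1 - e6 + h0
  have x3 : coeff 0 (d 3) = 0 := by linear_combination -2 * e0 + e3 + e4 + e5 - e6 + e8 + e10 + h0
  have x4 : coeff 0 (d 4) = 0 := by linear_combination -3 * e0 - e1 + e4 + e5 - 2 * e6 - e7 + e8 + e10 + h0
  have x5 : coeff 0 (d 5) = 0 := by linear_combination -3 * e0 - e1 + e2 + 2 * e4 + 3 * e5 - 2 * e6 - e7 + e8 + e9 + 2 * e10 + h0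
  have x6 : coeff 0 (d 6) = 0 := by linear_combination -e0 + e3 + e4 + e5 + e8 + e10 + h0
  have x7 : coeff 0 (d 7) = 0 := by linear_combination -2 * e0 - e1 + e4 + 2 * e5 - e6 + e8 + e10 + h0
  have x8 : coeff 0 (d 8) = 0 := by linear_combination -3 * e0 - e1 + e4 + 2 * e5 - 2 * e6 - e7 + e8 + e10 + h0
  have x9 : coeff 0 (d 9) = 0 := by linear_combination -3 * e0 - 2 * e1 - e2 - e3 - 2 * e6 - e7 + h0
  have x10 : coeff 0 (d 10) = 0 := by linear_combination -3 * e0 - e1 + e4 + 2 * e5 - 2 * e6 - e7 + e8 + e9 + 2 * e10 + h0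
  have x11 : coeff 0 (d 11) = 0 := by linear_combination -3 * e0 - 2 * e1 - e2 - e3 + e5 - 2 * e6 - e7 + e10 + h0
  intro i
  fin_cases i <;> assumption

/-- The equations of the system, in a uniform shape. -/
theorem CorteelWelshSystem.exists_eq {d : Fin 12 → PowerSeries QLaurent}
    (hd : CorteelWelshSystem d) (S : AddSubgroup (PowerSeries QLaurent)) (hS : ∀ i, d i ∈ S)
    (i : Fin 12) : ∃ a ∈ S, ∃ b ∈ S, ∃ c ∈ S, d i = zShift 1 a
      - (1 - zVar * qVar) * zShift 2 b
      + (1 - zVar * qVar) * (1 - zVar * qVar ^ 2) * zShift 3 c := by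
  fin_cases i
  · refine ⟨d 1, (hS 1), 0, zero_mem S, 0, zero_mem S, hd.eq_700.trans ?_⟩
    simp only [map_zero]
    ring
  · refine ⟨d 2 + d 6, (add_mem (hS 2) (hS 6)), d 3, (hS 3), 0, zero_mem S, hd.eq_610.trans ?_⟩
    simp only [map_add, map_zero]
    ring
  · refine ⟨d 9 + d 3, (add_mem (hS 9) (hS 3)), d 4, (hS 4), 0, zero_mem S, hd.eq_520.trans ?_⟩
    simp only [map_add, map_zero]
    ring
  · refine ⟨d 4 + d 7 + d 1, (add_mem (add_mem (hS 4) (hS 7)) (hS 1)), d 8 + d 2 + d 6, (add_mem (add_mem (hS 8) (hS 2)) (hS 6)), d 3, (hS 3), hd.eq_511.trans ?_⟩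
    simp only [map_add]
  · refine ⟨d 10 + d 8 + d 2, (add_mem (add_mem (hS 10) (hS 8)) (hS 2)), d 5 + d 9 + d 3, (add_mem (add_mem (hS 5) (hS 9)) (hS 3)), d 4, (hS 4), hd.eq_421.trans ?_⟩
    simp only [map_add]
  · refine ⟨d 5 + d 10 + d 4, (add_mem (add_mem (hS 5) (hS 10)) (hS 4)), d 5 + d 10 + d 8, (add_mem (add_mem (hS 5) (hS 10)) (hS 8)), d 5, (hS 5), hd.eq_322.trans ?_⟩
    simp only [map_add]
  · refine ⟨d 3 + d 0, (add_mem (hS 3) (hS 0)), d 1, (hS 1), 0, zero_mem S, hd.eq_601.trans ?_⟩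
    simp only [map_add, map_zero]
    ring
  · refine ⟨d 8 + d 6, (add_mem (hS 8) (hS 6)), d 3, (hS 3), 0, zero_mem S, hd.eq_502.trans ?_⟩
    simp only [map_add, map_zero]
    ring
  · refine ⟨d 5 + d 11 + d 3, (add_mem (add_mem (hS 5) (hS 11)) (hS 3)), d 10 + d 4 + d 7, (add_mem (add_mem (hS 10) (hS 4)) (hS 7)), d 8, (hS 8), hd.eq_412.trans ?_⟩
    simp only [map_add]
  · refine ⟨d 11 + d 4, (add_mem (hS 11) (hS 4)), d 10, (hS 10), 0, zero_mem S, hd.eq_430.trans ?_⟩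
    simp only [map_add, map_zero]
    ring
  · refine ⟨d 8 + d 5 + d 9, (add_mem (add_mem (hS 8) (hS 5)) (hS 9)), d 5 + d 11 + d 4, (add_mem (add_mem (hS 5) (hS 11)) (hS 4)), d 10, (hS 10), hd.eq_331.trans ?_⟩
    simp only [map_add]
  · refine ⟨d 10 + d 7, (add_mem (hS 10) (hS 7)), d 8, (hS 8), 0, zero_mem S, hd.eq_403.trans ?_⟩
    simp only [map_add, map_zero]
    ring

/-! ### Uniqueness of the solution -/

theorem coeff_zShift (k n : ℕ) (f : PowerSeries QLaurent) :
    coeff n (zShift k f) = qPow (k * n : ℕ) * coeff n f := by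
  rw [zShift, coeff_rescale, ← qPow_one_pow, ← pow_mul, qPow_one_pow]

theorem coeff_mul_of_coeff_lt_eq_zero {R : Type*} [CommSemiring R] (p : PowerSeries R)
    {f : PowerSeries R} {n : ℕ} (h : ∀ m < n, coeff m f = 0) :
    coeff n (p * f) = coeff 0 p * coeff n f := by
  rw [coeff_mul, Finset.sum_eq_single (0, n)]
  · rintro ⟨a, b⟩ hab hne
    have hab := Finset.HasAntidiagonal.mem_antidiagonal.1 hab
    rw [h b, mul_zero]
    by_contra hb
    exact hne (Prod.ext (by simp at *; omega) (by simp at *; omega))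
  · intro h0
    exact absurd (Finset.HasAntidiagonal.mem_antidiagonal.2 (zero_add n)) h0

theorem coeff_qPow_mul (e g : ℤ) (x : QLaurent) : (qPow e * x).coeff g = x.coeff (g - e) := by
  rw [qPow, HahnSeries.coeff_single_mul, one_mul]

/-- The series whose coefficients of `z^m` vanish for `m < n`, and whose coefficient of `z^n` has
no term in `q^g` with `g < l`. -/
def vanishingSubgroup (n : ℕ) (l : ℤ) : AddSubgroup (PowerSeries QLaurent) where
  carrier := {f | (∀ m < n, coeff m f = 0) ∧ ∀ g < l, (coeff n f).coeff g = 0}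
  add_mem' := fun ⟨ha, ha'⟩ ⟨hb, hb'⟩ =>
    ⟨fun m hm => by rw [map_add, ha m hm, hb m hm, add_zero], fun g hg => by
      rw [map_add, HahnSeries.coeff_add, ha' g hg, hb' g hg, add_zero]⟩
  zero_mem' := ⟨fun m _ => by simp, fun g _ => by simp⟩
  neg_mem' := fun ⟨ha, ha'⟩ =>
    ⟨fun m hm => by rw [map_neg, ha m hm, neg_zero], fun g hg => by
      rw [map_neg, HahnSeries.coeff_neg, ha' g hg, neg_zero]⟩

theorem CorteelWelshSystem.eq_zero {d : Fin 12 → PowerSeries QLaurent}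
    (hd : CorteelWelshSystem d) (h0 : coeff 0 (d 0) = 0) (i : Fin 12) : d i = 0 := by
  have main : ∀ n i, coeff n (d i) = 0 := by
    intro n
    induction n using Nat.strong_induction_on with
    | _ n ih =>
    rcases Nat.eq_zero_or_pos n with rfl | hn
    · exact hd.coeff_zero_eq_zero h0
    -- A common lower bound for the powers of $q$ in the twelve coefficients of $z^n$. The order of
    -- a zero coefficient is $0$ by convention, which does no harm.
    obtain ⟨l, hl⟩ := (Set.finite_range fun i => (coeff n (d i)).order).bddBelow
    -- In degree $n\ge1$ the shifts multiply by $q^n$, $q^{2n}$, $q^{3n}$, so each use of the system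
    -- raises the bound by at least one. The prefactors count only through their constant term $1$,
    -- as all lower degrees vanish.
    have step : ∀ m : ℕ, ∀ i, ∀ g < l + m, (coeff n (d i)).coeff g = 0 := by
      intro m
      induction m with
      | zero =>
        intro i g hg
        have : l ≤ (coeff n (d i)).order := hl ⟨i, rfl⟩
        exact HahnSeries.coeff_eq_zero_of_lt_order (by push_cast at hg; omega)
      | succ m ihm =>
        intro i g hg
        obtain ⟨a, ha, b, hb, c, hc, he⟩ := hd.exists_eq (vanishingSubgroup n (l + m))
          (fun i => ⟨fun k hk => ih k hk i, ihm i⟩) i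
        have hlow : ∀ {f} k, f ∈ vanishingSubgroup n (l + m) →
            ∀ j < n, coeff j (zShift k f) = 0 := fun k hf j hj => by
          rw [coeff_zShift, hf.1 j hj, mul_zero]
        have hcz : coeff 0 (zVar : PowerSeries QLaurent) = 0 := coeff_zero_X
        have h2 : coeff 0 (1 - zVar * qVar : PowerSeries QLaurent) = 1 := by
          simp [zVar]
        have h3 : coeff 0 ((1 - zVar * qVar) * (1 - zVar * qVar ^ 2) : PowerSeries QLaurent) = 1 := by
          simp [zVar]
        push_cast at hg
        rw [he, map_add, map_sub, coeff_mul_of_coeff_lt_eq_zero _ (hlow 2 hb),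
          coeff_mul_of_coeff_lt_eq_zero _ (hlow 3 hc), h2, h3, one_mul, one_mul, coeff_zShift,
          coeff_zShift, coeff_zShift, HahnSeries.coeff_add, HahnSeries.coeff_sub, coeff_qPow_mul,
          coeff_qPow_mul, coeff_qPow_mul, ha.2 _ (by push_cast; omega),
          hb.2 _ (by push_cast; omega), hc.2 _ (by push_cast; omega)]
        simp
    intro i
    ext g
    exact step (g - l + 1).toNat i g (by omega)
  ext1 n
  rw [main, map_zero]

/-! ### The constant term of `S_10(1, 1 | 1, 1)` -/

theorem invPoch_mul_qPoch (n : ℕ) : invPoch n * qPoch (X : PowerSeries ℚ) X n = 1 := by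
  rw [invPoch, if_pos (by omega), Int.toNat_natCast]
  exact PowerSeries.inv_mul_cancel _ (by simp [constantCoeff_qPoch_X])

theorem one_sub_X_pow_succ_ne_zero (m : ℕ) : (1 - X ^ (m + 1) : PowerSeries ℚ) ≠ 0 := fun h => by
  have := congrArg constantCoeff h
  simp at this

/-- A case of the `q`-Chu–Vandermonde summation. -/
theorem sum_X_pow_mul_invPoch (N k : ℕ) :
    ∑ s ∈ Finset.range (N + 1), X ^ (s ^ 2 + k * s) *
      (invPoch ((N : ℤ) - s) * invPoch s * invPoch ((s : ℤ) + k)) =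
    invPoch N * invPoch ((N : ℤ) + k) := by
  have hneg : invPoch (-1) = 0 := rfl
  have hstep : ∀ m : ℕ, (1 - X ^ m) * invPoch m = invPoch ((m : ℤ) - 1) := by
    rintro (_ | m)
    · simp [hneg]
    · push_cast
      rw [one_sub_X_pow_mul_invPoch, add_sub_cancel_right]
  induction N generalizing k with
  | zero => simp [invPoch, qPoch]
  | succ N ih =>
    refine mul_left_cancel₀ (one_sub_X_pow_succ_ne_zero N) ?_
    -- Here $1-q^{N+1}=(1-q^{N+1-s})+q^{N+1-s}(1-q^s)$. The first piece gives the sum for $(N,k)$;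
    -- the second, after $s\mapsto s+1$, gives $q^{N+k+1}$ times the sum for $(N,k+1)$, hence the
    -- induction for all `k`.
    have h1 : ∀ s ∈ Finset.range (N + 2), (1 - X ^ (N + 1)) * (X ^ (s ^ 2 + k * s) *
        (invPoch (((N + 1 : ℕ) : ℤ) - s) * invPoch s * invPoch ((s : ℤ) + k))) =
        X ^ (s ^ 2 + k * s) * (invPoch ((N : ℤ) - s) * invPoch s * invPoch ((s : ℤ) + k)) +
        X ^ (s ^ 2 + k * s + (N + 1 - s)) *
          (invPoch (((N + 1 : ℕ) : ℤ) - s) * invPoch ((s : ℤ) - 1) * invPoch ((s : ℤ) + k)) := by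
      intro s hs
      obtain ⟨t, ht⟩ : ∃ t, N + 1 = s + t := Nat.exists_eq_add_of_le (by simp at hs; omega)
      have e1 : ((N + 1 : ℕ) : ℤ) - s = t := by rw [ht]; push_cast; ring
      have e2 : (N : ℤ) - s = t - 1 := by push_cast at e1; linarith
      rw [e1, e2, ← hstep, ← hstep, ht, Nat.add_sub_cancel_left, pow_add X s t, pow_add _ _ t]
      ring
    rw [Finset.mul_sum, Finset.sum_congr rfl h1, Finset.sum_add_distrib, Finset.sum_range_succ]
    have h2 : (N : ℤ) - ((N + 1 : ℕ) : ℤ) = -1 := by push_cast; ring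
    rw [h2, hneg, ih, Finset.sum_range_succ']
    have h3 : ∀ s ∈ Finset.range (N + 1), X ^ ((s + 1) ^ 2 + k * (s + 1) + (N + 1 - (s + 1))) *
        (invPoch (((N + 1 : ℕ) : ℤ) - ((s + 1 : ℕ) : ℤ)) * invPoch (((s + 1 : ℕ) : ℤ) - 1) *
          invPoch (((s + 1 : ℕ) : ℤ) + k)) =
        X ^ (N + k + 1) * (X ^ (s ^ 2 + (k + 1) * s) * (invPoch ((N : ℤ) - s) * invPoch s *
          invPoch ((s : ℤ) + (k + 1 : ℕ)))) := by
      intro s hs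
      obtain ⟨t, rfl⟩ : ∃ t, N = s + t := Nat.exists_eq_add_of_le (by simp at hs; omega)
      rw [← mul_assoc (X ^ (s + t + k + 1)), ← pow_add]
      congr 2
      · rw [show s + t + 1 - (s + 1) = t by omega]; ring
      · push_cast; congr 2 <;> ring_nf
      · push_cast; ring_nf
    rw [Finset.sum_congr rfl h3, ← Finset.mul_sum, ih]
    have h4 := one_sub_X_pow_mul_invPoch (N + k)
    have h5 := one_sub_X_pow_mul_invPoch N
    have e3 : (((N + k : ℕ) : ℤ) + 1) = (N : ℤ) + (k + 1 : ℕ) := by push_cast; ring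
    have e4 : (((N + 1 : ℕ) : ℤ) + k) = (N : ℤ) + (k + 1 : ℕ) := by push_cast; ring
    have e5 : ((0 : ℕ) : ℤ) - 1 = -1 := rfl
    rw [e3] at h4
    rw [e4, e5, hneg]
    push_cast at h4 h5 ⊢
    rw [← h4, ← h5]
    ring

theorem X_pow_dvd_qPoch_mul_invPoch_sub_one (m s : ℕ) :
    X ^ (m + 1) ∣ qPoch (X : PowerSeries ℚ) X (m + s) * invPoch m - 1 := by
  induction s with
  | zero => rw [add_zero, mul_comm, invPoch_mul_qPoch, sub_self]; exact dvd_zero _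
  | succ s ih =>
    obtain ⟨u, hu⟩ := ih
    refine ⟨u - X ^ s * (qPoch X X (m + s) * invPoch m), ?_⟩
    rw [← add_assoc, qPoch, Finset.prod_range_succ, ← qPoch]
    linear_combination hu

/-- The partial sums of the Durfee rectangle expansion of `1 / (q)_∞`. -/
noncomputable def durfeeSum (M : ℕ) : PowerSeries ℚ :=
  ∑ s ∈ Finset.range (M + 1), X ^ (s ^ 2 + s) * (invPoch s * invPoch ((s : ℤ) + 1))

/-- The summation above with $k=1$, multiplied by $(q)_M$, has value $1/(q)_{M+1}$. Its terms
contain $(q)_M/(q)_{M-s}\equiv1$ modulo $q^{M-s+1}$, and the factor $q^{s^2+s}$ lifts the error to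
order at least $M+1$. -/
theorem X_pow_dvd_qPoch_mul_durfeeSum_sub_one (M : ℕ) :
    X ^ (M + 1) ∣ qPoch (X : PowerSeries ℚ) X (M + 1) * durfeeSum M - 1 := by
  have h1 : X ^ (M + 1) ∣ qPoch (X : PowerSeries ℚ) X M * (∑ s ∈ Finset.range (M + 1),
      X ^ (s ^ 2 + 1 * s) * (invPoch ((M : ℤ) - s) * invPoch s * invPoch ((s : ℤ) + (1 : ℕ))))
      - durfeeSum M := by
    rw [durfeeSum, Finset.mul_sum, ← Finset.sum_sub_distrib]
    refine Finset.dvd_sum fun s hs => ?_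
    obtain ⟨t, rfl⟩ : ∃ t, M = t + s :=
      ⟨M - s, (Nat.sub_add_cancel (by simp at hs; omega)).symm⟩
    obtain ⟨u, hu⟩ := X_pow_dvd_qPoch_mul_invPoch_sub_one t s
    have e : ((t + s : ℕ) : ℤ) - s = t := by push_cast; ring
    refine ⟨X ^ (s ^ 2) * (u * (invPoch s * invPoch ((s : ℤ) + 1))), ?_⟩
    rw [e, Nat.cast_one]
    linear_combination X ^ (s ^ 2 + s) * (invPoch s * invPoch ((s : ℤ) + 1)) * hu
  rw [sum_X_pow_mul_invPoch] at h1
  have h2 := invPoch_mul_qPoch M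
  have h3 := invPoch_mul_qPoch (M + 1)
  have h4 : qPoch (X : PowerSeries ℚ) X (M + 1) * durfeeSum M - 1 =
      -(qPoch X X (M + 1) * (qPoch (X : PowerSeries ℚ) X M * (invPoch M * invPoch ((M : ℤ) + (1 : ℕ)))
        - durfeeSum M)) := by
    push_cast at h3 ⊢
    linear_combination h3 + qPoch X X (M + 1) * invPoch ((M : ℤ) + 1) * h2
  rw [h4]
  exact (h1.mul_left _).neg_right

theorem X_pow_dvd_eulerProd_sub_qPoch (M : ℕ) :
    X ^ (M + 1) ∣ eulerProd - qPoch (X : PowerSeries ℚ) X (M + 1) := by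
  rw [X_pow_dvd_iff]
  intro m hm
  rw [map_sub, sub_eq_zero, eulerProd, ← coeff_qPoch_eq _ 0 m (M + 1) (by omega)]
  congr 1
  simp [qPoch, coeff_zero_eq_constantCoeff_apply, map_prod]

/-- The Durfee rectangle expansion of `1 / (q)_∞`. -/
noncomputable def durfeeSeries : PowerSeries ℚ := PowerSeries.mk fun N => coeff N (durfeeSum N)

theorem coeff_durfeeSum (N M : ℕ) (h : N ≤ M) : coeff N (durfeeSum M) = coeff N durfeeSeries := by
  induction M, h using Nat.le_induction with
  | base => simp [durfeeSeries]
  | succ M hM ih =>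
    rw [durfeeSum, Finset.sum_range_succ, ← durfeeSum, map_add, ih, coeff_X_pow_mul',
      if_neg (by nlinarith), add_zero]

theorem durfeeSeries_mul_eulerProd : durfeeSeries * eulerProd = 1 := by
  rw [← sub_eq_zero]
  ext N
  have h1 : X ^ (N + 1) ∣ durfeeSeries - durfeeSum N := by
    rw [X_pow_dvd_iff]
    intro m hm
    rw [map_sub, coeff_durfeeSum m N (by omega), sub_self]
  have h2 : X ^ (N + 1) ∣ durfeeSeries * eulerProd - 1 := by
    have h3 : durfeeSeries * eulerProd - 1 = (durfeeSeries - durfeeSum N) * eulerProd +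
        durfeeSum N * (eulerProd - qPoch (X : PowerSeries ℚ) X (N + 1)) +
        (qPoch (X : PowerSeries ℚ) X (N + 1) * durfeeSum N - 1) := by ring
    rw [h3]
    exact ((h1.mul_right _).add ((X_pow_dvd_eulerProd_sub_qPoch N).mul_left _)).add
      (X_pow_dvd_qPoch_mul_durfeeSum_sub_one N)
  rw [X_pow_dvd_iff] at h2
  simpa using h2 N (by omega)

theorem term_zero_zero (s₁ s₂ : ℕ) : term 1 1 1 1 0 0 s₁ s₂ = HahnSeries.ofPowerSeries ℤ ℚ
    (X ^ (s₁ ^ 2 + s₁) * (X ^ (s₂ ^ 2 + 1 * s₂) *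
      (invPoch ((s₁ : ℤ) - s₂) * invPoch s₂ * invPoch ((s₂ : ℤ) + (1 : ℕ))))) := by
  have h0 : invPoch 0 = 1 := by simp [invPoch, qPoch]
  have he : expo 1 1 1 1 0 0 s₁ s₂ = ((s₁ ^ 2 + s₁ + (s₂ ^ 2 + 1 * s₂) : ℕ) : ℤ) := by
    simp only [expo]; push_cast; ring
  rw [← mul_assoc, ← pow_add, map_mul, ofPowerSeries_X_pow, ← he, term, qPow]
  simp [h0]

theorem coeff_zero_S10_one : coeff 0 (S10 1 1 1 1) = HahnSeries.ofPowerSeries ℤ ℚ durfeeSeries := by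
  rw [coeff_S10]
  ext g
  rw [HahnSeries.SummableFamily.coeff_hsum]
  have hexpo : ∀ s₁ s₂ : ℕ, (s₁ : ℤ) + s₂ ≤ expo 1 1 1 1 0 0 s₁ s₂ := fun s₁ s₂ => by
    simp only [expo]; push_cast; nlinarith
  rcases lt_or_ge g 0 with hg | hg
  · rw [finsum_eq_zero_of_forall_eq_zero]
    · exact ((PowerSeries.coeff_coe _ _).trans (if_pos hg)).symm
    · rintro ⟨r₂, s₁, s₂⟩
      by_contra hne
      obtain ⟨h1, h2⟩ := le_of_term_coeff_ne_zero hne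
      obtain rfl : r₂ = 0 := by simpa using h1
      have := hexpo s₁ s₂
      change expo 1 1 1 1 0 0 s₁ s₂ ≤ _ at h2
      omega
  · lift g to ℕ using hg with N
    rw [HahnSeries.ofPowerSeries_apply_coeff, ← coeff_durfeeSum N N le_rfl,
      finsum_eq_sum_of_support_subset
        (s := {0} ×ˢ (Finset.range (N + 1) ×ˢ Finset.range (N + 1))) _ ?_]
    · rw [Finset.sum_product, Finset.sum_singleton, Finset.sum_product, durfeeSum, map_sum]
      refine Finset.sum_congr rfl fun s₁ hs₁ => ?_
      simp only [termFamily_apply, term_zero_zero, HahnSeries.ofPowerSeries_apply_coeff]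
      rw [← map_sum, ← Finset.mul_sum]
      congr 2
      have hle : s₁ + 1 ≤ N + 1 := by simpa [Nat.succ_le_iff] using hs₁
      -- Terms with $s_2>s_1$ vanish through $1/(q)_{s_1-s_2}$; the others sum to
      -- $1/((q)_{s_1}(q)_{s_1+1})$, which is a Durfee term.
      rw [← Finset.sum_subset (Finset.range_mono hle), sum_X_pow_mul_invPoch, Nat.cast_one]
      intro s₂ _ hs₂
      rw [invPoch, if_neg (by simp at hs₂; omega)]
      simp
    · rintro ⟨r₂, s₁, s₂⟩ hne
      obtain ⟨h1, h2⟩ := le_of_term_coeff_ne_zero hne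
      obtain rfl : r₂ = 0 := by simpa using h1
      have := hexpo s₁ s₂
      change expo 1 1 1 1 0 0 s₁ s₂ ≤ _ at h2
      simp
      omega

/-! ### Comparison of the two solutions. -/

theorem profileSide_eq_sumSide (i : Fin 12) : profileSide i = sumSide i := by
  have h := (profileSide_system.sub sumSide_system).eq_zero ?_ i
  · exact sub_eq_zero.1 h
  · have h1 : coeff 0 (H ![7, 0, 0]) * HahnSeries.ofPowerSeries ℤ ℚ eulerProd = 1 :=
      coeff_zero_H_mul _
    have h2 : coeff 0 (S10 1 1 1 1) * HahnSeries.ofPowerSeries ℤ ℚ eulerProd = 1 := by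
      rw [coeff_zero_S10_one, ← map_mul, durfeeSeries_mul_eulerProd, map_one]
    change coeff 0 (H ![7, 0, 0] - S10 1 1 1 1) = 0
    rw [map_sub]
    linear_combination coeff 0 (S10 1 1 1 1) * h1 - coeff 0 (H ![7, 0, 0]) * h2

end ASW

theorem mainTheorem2 (i : Fin 3) :
    H (rot i ![7, 0, 0]) = S10 1 1 1 1 ∧
    H (rot i ![6, 1, 0]) = S10 0 1 1 1 ∧
    H (rot i ![5, 2, 0]) = S10 0 0 1 1 ∧
    H (rot i ![5, 1, 1]) = S10 0 1 0 1 - qVar * S10 1 1 1 1 ∧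
    H (rot i ![4, 2, 1]) = S10 0 0 0 1 - qVar * S10 0 1 1 1 ∧
    H (rot i ![3, 2, 2]) = S10 0 0 0 0 - qVar * S10 0 1 0 1 ∧
    H (rot i ![6, 0, 1]) = S10 1 1 0 1 - qVar * (1 - zVar) * S10 2 1 1 1 ∧
    H (rot i ![5, 0, 2]) = S10 1 1 0 0 - qVar * (1 - zVar) * S10 2 1 0 1 ∧
    H (rot i ![4, 1, 2]) = S10 0 1 0 0 - qVar * S10 1 1 0 1 ∧
    H (rot i ![4, 3, 0]) =
      S10 (-1) 0 1 1 - S10 0 1 0 1 + (1 - zVar) * S10 1 0 0 1 + zVar * qVar * S10 1 1 1 1 ∧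
    H (rot i ![3, 3, 1]) =
      S10 (-1) 0 0 1 - S10 0 1 0 0 + (1 - zVar) * S10 1 0 0 0 + zVar * qVar * S10 1 1 0 1
        - qVar * S10 (-1) 1 1 1 - zVar * S10 0 0 1 1 ∧
    H (rot i ![4, 0, 3]) =
      S10 0 0 0 1 - qVar * S10 0 1 1 1 - zVar * qVar * S10 1 0 1 1 - S10 1 1 0 0
        + (1 - qVar * zVar) * S10 2 0 0 0 + zVar * qVar ^ 2 * S10 2 1 0 1
        + zVar * qVar * S10 2 1 0 0 := by
  simp only [H_rot]
  exact ⟨profileSide_eq_sumSide 0, profileSide_eq_sumSide 1, profileSide_eq_sumSide 2,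
    profileSide_eq_sumSide 3, profileSide_eq_sumSide 4, profileSide_eq_sumSide 5,
    profileSide_eq_sumSide 6, profileSide_eq_sumSide 7, profileSide_eq_sumSide 8,
    profileSide_eq_sumSide 9, profileSide_eq_sumSide 10, profileSide_eq_sumSide 11⟩
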